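/- Let $\mathbb Y,\mathbb Z,\mathbb X$ be finite-dimensional real Euclidean spaces, $f_1:\mathbb Y\to(-\infty,+\infty]$ and $f_2:\mathbb Z\to(-\infty,+\infty]$ proper closed convex functions, $B_1:\mathbb Y\to\mathbb X$, $B_2:\mathbb Z\to\mathbb X$ linear operators and $c\in\mathbb X$. Consider $$\min_{y,z}\ f_1(y)+f_2(z)\quad\text{subject to}\quad B_1y+B_2z=c ,$$ with KKT system $$-B_1^*x\in\partial f_1(y),\qquad -B_2^*x\in\partial f_2(z),\qquad B_1y+B_2z-c=0 .$$ Let $\mathcal T_1,\mathcal T_2$ be self-adjoint positive semidefinite operators on $\mathbb Y,\mathbb Z$; write $\|u\|_{\mathcal S}=\sqrt{\langle u,\mathcal S u\rangle}$ for a self-adjoint positive semidefinite $\mathcal S$. Let $\Sigma_{f_1},\Sigma_{f_2}$ be self-adjoint positive semidefinite operators such that for $f=f_1,f_2$ and all $u,\hat u\in\operatorname{dom} f$, $\phi\in\partial f(u)$, $\hat\phi\in\partial f(\hat u)$, $$f(u)\ge f(\hat u)+\langle\hat\phi,u-\hat u\rangle+\tfrac12\|u-\hat u\|_{\Sigma_f}^2,\qquad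 \langle\phi-\hat\phi,u-\hat u\rangle\ge\|u-\hat u\|_{\Sigma_f}^2 .$$ Assume that the KKT system has a solution and that $\Sigma_{f_i}+B_i^*B_i+\mathcal T_i$ is positive definite for $i=1,2$. Let $\sigma>0$, $\alpha\ge2$, $\rho\in(0,2]$, and put $$\ell_\sigma(y,z;x)=\langle x,B_1y+B_2z-c\rangle+\tfrac\sigma2\|B_1y+B_2z-c\|^2 .$$ The accelerated pADMM starts from $\hat w^0=w^0=(y^0,z^0,x^0)\in\operatorname{dom}f_1\times\operatorname{dom}f_2\times\mathbb X$ and generates, for $k=0,1,\dots$, with $w^k=(y^k,z^k,x^k)$ and $\bar w^k=(\bar y^k,\bar z^k,\bar x^k)$, $$\begin{aligned} \bar z^k&=\operatorname*{arg\,min}_{z}\bigl\{f_2(z)+\ell_\sigma(y^k,z;x^k)+\tfrac12\|z-z^k\|_{\mathcal T_2}^2\bigr\},\\ \bar x^k&=x^k+\sigma(B_1y^k+B_2\bar z^k-c),\\ \bar y^k&=\operatorname*{arg\,min}_{y}\bigl\{f_1(y)+\ell_\sigma(y,\bar z^k;\bar x^k)+\tfrac12\|y-y^k\|_{\mathcal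 T_1}^2\bigr\},\\ \hat w^{k+1}&=(1-\rho)w^k+\rho\bar w^k,\\ w^{k+1}&=w^k+\tfrac{\alpha}{2(k+\alpha)}(\hat w^{k+1}-w^k)+\tfrac{k}{k+\alpha}(\hat w^{k+1}-\hat w^k). \end{aligned}$$ With $\operatorname{Prox}_f(v)=\operatorname*{arg\,min}_u\{f(u)+\frac12\|u-v\|^2\}$, define on $\mathbb Y\times\mathbb Z\times\mathbb X$ (with its Euclidean norm) $$\mathcal R(w)=\begin{pmatrix}y-\operatorname{Prox}_{f_1}(y-B_1^*x)\\ z-\operatorname{Prox}_{f_2}(z-B_2^*x)\\ c-B_1y-B_2z\end{pmatrix},\qquad \mathcal M=\begin{pmatrix}\sigma B_1^*B_1+\mathcal T_1&0&B_1^*\\0&\mathcal T_2&0\\B_1&0&\sigma^{-1}\mathcal I\end{pmatrix},$$ and set $C=\frac{\sigma\|B_1^*\|+1}{\sqrt\sigma}+\|\sqrt{\mathcal T_2}\|+\|\sqrt{\mathcal T_1}\|$. Then the sequence $(\bar w^k)$ converges to a point $w^*=(y^*,z^*,x^*)$, this limit solves the KKT system, and $f_1(\bar y^k),f_2(\bar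 z^k),f_1(y^*),f_2(z^*)$ are finite. Put $R_0=\|w^0-w^*\|_{\mathcal M}$ and $h(\bar y^k,\bar z^k)=f_1(\bar y^k)+f_2(\bar z^k)-f_1(y^*)-f_2(z^*)$. (a) If $\alpha=2$, then for all $k\ge0$ $$\|\mathcal R(\bar w^k)\|\le C\,\frac{2R_0}{\rho(k+1)},\qquad -\frac{\|x^*\|}{\sqrt\sigma}\,\frac{2R_0}{\rho(k+1)}\le h(\bar y^k,\bar z^k)\le\Bigl(3R_0+\frac{\|x^*\|}{\sqrt\sigma}\Bigr)\frac{2R_0}{\rho(k+1)} .$$ (b) If $\alpha>2$, then, as $k\to\infty$, $$\|\mathcal R(\bar w^k)\|=C\cdot o\!\left(\frac1{k+1}\right),\qquad |h(\bar y^k,\bar z^k)|=o\!\left(\frac1{k+1}\right).$$ -/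

import Mathlib

open scoped Asymptotics

noncomputable section

namespace AccPADMM

variable {E : Type*} [NormedAddCommGroup E] [InnerProductSpace ℝ E]

/-! ### Convex analysis -/

/-- The effective domain of an extended-real-valued function. -/
def effDom (f : E → EReal) : Set E := {y | f y < ⊤}

/-- `f : E → (-∞, +∞]` is proper, closed (lower semicontinuous) and convex (convex epigraph). -/
structure ProperClosedConvex (f : E → EReal) : Prop where
  ne_bot : ∀ y, f y ≠ ⊥
  nonempty_dom : (effDom f).Nonempty
  closed : LowerSemicontinuous f
  convex : Convex ℝ {p : E × ℝ | f p.1 ≤ (p.2 : EReal)}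

/-- The subdifferential of `f` at `y` in the sense of convex analysis. -/
def subdiff (f : E → EReal) (y : E) : Set E :=
  {v | ∀ u, f y + ((inner ℝ v (u - y) : ℝ) : EReal) ≤ f u}

open Classical in
/-- The proximal mapping `Prox_f (x) = argmin_u { f u + ½ ‖u - x‖² }`. For a proper closed convex
function the minimizer exists and is unique. -/
def prox (f : E → EReal) (x : E) : E :=
  if h : ∃ p, IsMinOn (fun u => f u + ((1 / 2 * ‖u - x‖ ^ 2 : ℝ) : EReal)) Set.univ p
  then h.choose else 0

/-! ### Linear operators -/

/-- A self-adjoint positive definite linear operator. -/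
def IsPosDef (T : E →ₗ[ℝ] E) : Prop :=
  T.IsSymmetric ∧ ∀ x, x ≠ 0 → 0 < inner ℝ x (T x)

/-- The seminorm `‖x‖_T = √⟨x, T x⟩` of a self-adjoint positive semidefinite operator. -/
def opSeminorm (T : E →ₗ[ℝ] E) (x : E) : ℝ := √(inner ℝ x (T x))

/-- The operator norm of a linear map between finite-dimensional Euclidean spaces. -/
def opNorm {F : Type*} [NormedAddCommGroup F] [InnerProductSpace ℝ F] [FiniteDimensional ℝ E]
    (T : E →ₗ[ℝ] F) : ℝ := ‖LinearMap.toContinuousLinearMap T‖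

open Classical in
/-- The self-adjoint positive semidefinite square root of a self-adjoint positive semidefinite
operator. -/
def sqrtOp (T : E →ₗ[ℝ] E) : E →ₗ[ℝ] E :=
  if h : ∃ S : E →ₗ[ℝ] E, S.IsPositive ∧ S ∘ₗ S = T then h.choose else 0

/-- The square root exists for every self-adjoint positive semidefinite operator. -/
theorem sqrtOp_spec [FiniteDimensional ℝ E] (T : E →ₗ[ℝ] E) (hT : T.IsPositive) :
    (sqrtOp T).IsPositive ∧ sqrtOp T ∘ₗ sqrtOp T = T := by
  have key : ∃ S : E →ₗ[ℝ] E, S.IsPositive ∧ S ∘ₗ S = T := by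
    let b := hT.isSymmetric.eigenvectorBasis rfl
    let l := hT.isSymmetric.eigenvalues rfl
    let S : E →ₗ[ℝ] E := b.toBasis.constr ℝ (fun i => √(l i) • b i)
    have hS : ∀ i, S (b i) = √(l i) • b i := fun i => by
      have := b.toBasis.constr_basis ℝ (fun i => √(l i) • b i) i
      simp [S] at this ⊢
    have hl : ∀ i, 0 ≤ l i := fun i => hT.nonneg_eigenvalues rfl i
    have hSx : ∀ x, S x = ∑ i, (√(l i) * inner ℝ (b i) x) • b i := fun x => by
      conv_lhs => rw [← b.sum_repr x]
      simp only [map_sum, map_smul, hS, b.repr_apply_apply, smul_smul]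
      exact Finset.sum_congr rfl fun i _ => by rw [mul_comm]
    refine ⟨S, ⟨fun x y => ?_, fun x => ?_⟩, ?_⟩
    · rw [hSx, hSx, sum_inner, inner_sum]
      refine Finset.sum_congr rfl fun i _ => ?_
      rw [real_inner_smul_left, real_inner_smul_right, real_inner_comm x (b i)]
      ring
    · rw [hSx, sum_inner]
      simp only [real_inner_smul_left, RCLike.re_to_real]
      refine Finset.sum_nonneg fun i _ => ?_
      rw [mul_assoc]
      exact mul_nonneg (Real.sqrt_nonneg _) (mul_self_nonneg _)
    · refine b.toBasis.ext fun i => ?_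
      have h1 : T (b i) = l i • b i := hT.isSymmetric.apply_eigenvectorBasis rfl i
      simp only [OrthonormalBasis.coe_toBasis, LinearMap.comp_apply, hS, map_smul, smul_smul,
        Real.mul_self_sqrt (hl i), h1]
  unfold sqrtOp
  rw [dif_pos key]
  exact key.choose_spec

/-- `S` is a self-adjoint positive semidefinite operator measuring the strong convexity of `f` and
the strong monotonicity of its subdifferential (`S = 0` always qualifies). -/
structure IsConvexityOperator (f : E → EReal) (S : E →ₗ[ℝ] E) : Prop where
  isPositive : S.IsPositive
  strong_convex : ∀ y ∈ effDom f, ∀ u ∈ effDom f, ∀ v ∈ subdiff f u,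
    f u + ((inner ℝ v (y - u) + 1 / 2 * opSeminorm S (y - u) ^ 2 : ℝ) : EReal) ≤ f y
  strong_monotone : ∀ y ∈ effDom f, ∀ u ∈ effDom f, ∀ p ∈ subdiff f y, ∀ q ∈ subdiff f u,
    opSeminorm S (y - u) ^ 2 ≤ inner ℝ (p - q) (y - u)

/-! ### The two-block problem `min f₁(y) + f₂(z)` subject to `B₁ y + B₂ z = c` -/

variable {Y Z X : Type*}
  [NormedAddCommGroup Y] [InnerProductSpace ℝ Y] [FiniteDimensional ℝ Y]
  [NormedAddCommGroup Z] [InnerProductSpace ℝ Z] [FiniteDimensional ℝ Z]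
  [NormedAddCommGroup X] [InnerProductSpace ℝ X] [FiniteDimensional ℝ X]

/-- `w = (y, z, x)` solves the KKT system of the problem. -/
def IsKKT (f₁ : Y → EReal) (f₂ : Z → EReal) (B₁ : Y →ₗ[ℝ] X) (B₂ : Z →ₗ[ℝ] X) (c : X)
    (w : Y × Z × X) : Prop :=
  -LinearMap.adjoint B₁ w.2.2 ∈ subdiff f₁ w.1 ∧
  -LinearMap.adjoint B₂ w.2.2 ∈ subdiff f₂ w.2.1 ∧
  B₁ w.1 + B₂ w.2.1 - c = 0

/-- The part `⟨x, B₁ y + B₂ z - c⟩ + (σ/2) ‖B₁ y + B₂ z - c‖²` of the augmented Lagrangian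
`L_σ(y, z; x) = f₁ y + f₂ z + ⟨x, B₁ y + B₂ z - c⟩ + (σ/2) ‖B₁ y + B₂ z - c‖²`. -/
def augTerm (B₁ : Y →ₗ[ℝ] X) (B₂ : Z →ₗ[ℝ] X) (c : X) (σ : ℝ) (y : Y) (z : Z) (x : X) : ℝ :=
  inner ℝ x (B₁ y + B₂ z - c) + σ / 2 * ‖B₁ y + B₂ z - c‖ ^ 2

/-- The sequences `w^k`, `w̄^k`, `ŵ^k` are generated by the accelerated pADMM with the given data.
In each of the two subproblems the summand of `L_σ` that does not depend on the minimization
variable (`f₁ (y^k)`, respectively `f₂ (z̄^k)`) is an additive constant and is left out: the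
extrapolated point `y^k` may lie outside the effective domain of `f₁`, where this constant would be
infinite. -/
structure IsGenerated (f₁ : Y → EReal) (f₂ : Z → EReal) (B₁ : Y →ₗ[ℝ] X) (B₂ : Z →ₗ[ℝ] X) (c : X)
    (T₁ : Y →ₗ[ℝ] Y) (T₂ : Z →ₗ[ℝ] Z) (σ α ρ : ℝ) (w wbar what : ℕ → Y × Z × X) : Prop where
  init_y : (w 0).1 ∈ effDom f₁
  init_z : (w 0).2.1 ∈ effDom f₂
  init_hat : what 0 = w 0
  step1 : ∀ k, IsMinOn (fun z => f₂ z +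
      ((augTerm B₁ B₂ c σ (w k).1 z (w k).2.2
        + 1 / 2 * opSeminorm T₂ (z - (w k).2.1) ^ 2 : ℝ) : EReal))
      Set.univ (wbar k).2.1
  step2 : ∀ k, (wbar k).2.2 = (w k).2.2 + σ • (B₁ (w k).1 + B₂ (wbar k).2.1 - c)
  step3 : ∀ k, IsMinOn (fun y => f₁ y +
      ((augTerm B₁ B₂ c σ y (wbar k).2.1 (wbar k).2.2
        + 1 / 2 * opSeminorm T₁ (y - (w k).1) ^ 2 : ℝ) : EReal))
      Set.univ (wbar k).1
  step4 : ∀ k, what (k + 1) = (1 - ρ) • w k + ρ • wbar k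
  step5 : ∀ k : ℕ, w (k + 1) = w k + (α / (2 * ((k : ℝ) + α))) • (what (k + 1) - w k)
      + ((k : ℝ) / ((k : ℝ) + α)) • (what (k + 1) - what k)

/-! ### Quantities in the complexity bounds

`Y × Z × X` carries the Euclidean inner product `⟨y, y'⟩ + ⟨z, z'⟩ + ⟨x, x'⟩`, which is written out
here because the norm instance of `Prod` is the maximum norm. -/

/-- The Euclidean inner product on `Y × Z × X`. -/
def prodInner (u v : Y × Z × X) : ℝ :=
  inner ℝ u.1 v.1 + inner ℝ u.2.1 v.2.1 + inner ℝ u.2.2 v.2.2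

/-- The Euclidean norm on `Y × Z × X`. -/
def prodNorm (u : Y × Z × X) : ℝ := √(prodInner u u)

/-- The block operator `M`, with rows `(σ B₁* B₁ + T₁, 0, B₁*)`, `(0, T₂, 0)`, `(B₁, 0, σ⁻¹ I)`. -/
def opM (B₁ : Y →ₗ[ℝ] X) (T₁ : Y →ₗ[ℝ] Y) (T₂ : Z →ₗ[ℝ] Z) (σ : ℝ) (w : Y × Z × X) : Y × Z × X :=
  (σ • LinearMap.adjoint B₁ (B₁ w.1) + T₁ w.1 + LinearMap.adjoint B₁ w.2.2,
    T₂ w.2.1,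
    B₁ w.1 + σ⁻¹ • w.2.2)

/-- The seminorm `‖w‖_M = √⟨w, M w⟩`. -/
def seminormM (B₁ : Y →ₗ[ℝ] X) (T₁ : Y →ₗ[ℝ] Y) (T₂ : Z →ₗ[ℝ] Z) (σ : ℝ) (w : Y × Z × X) : ℝ :=
  √(prodInner w (opM B₁ T₁ T₂ σ w))

/-- The KKT residual mapping. -/
def kktResidual (f₁ : Y → EReal) (f₂ : Z → EReal) (B₁ : Y →ₗ[ℝ] X) (B₂ : Z →ₗ[ℝ] X) (c : X)
    (w : Y × Z × X) : Y × Z × X :=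
  (w.1 - prox f₁ (w.1 - LinearMap.adjoint B₁ w.2.2),
    w.2.1 - prox f₂ (w.2.1 - LinearMap.adjoint B₂ w.2.2),
    c - B₁ w.1 - B₂ w.2.1)

/-- The objective gap `f₁ y + f₂ z - f₁ y* - f₂ z*` as a real number, for points of the effective
domains. -/
def objGap (f₁ : Y → EReal) (f₂ : Z → EReal) (y : Y) (z : Z) (ystar : Y) (zstar : Z) : ℝ :=
  (f₁ y).toReal + (f₂ z).toReal - (f₁ ystar).toReal - (f₂ zstar).toReal

/-- The constant `(σ ‖B₁*‖ + 1) / √σ + ‖√T₂‖ + ‖√T₁‖`. -/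
def resConst (B₁ : Y →ₗ[ℝ] X) (T₁ : Y →ₗ[ℝ] Y) (T₂ : Z →ₗ[ℝ] Z) (σ : ℝ) : ℝ :=
  (σ * opNorm (LinearMap.adjoint B₁) + 1) / √σ + opNorm (sqrtOp T₂) + opNorm (sqrtOp T₁)

end AccPADMM

end

/-!
One step `w ↦ w̄` of pADMM is a proximal point step with the degenerate preconditioner `M`: the
optimality conditions of the two subproblems say that `M (w - w̄)` lies in the (monotone) KKT
operator at `w̄` (`IsGenerated.isProximalStep`). Factoring `M = L* L`, everything takes place in the
Hilbert space that is the target of `L`, where the relaxed residual `ρ L (w - w̄)` is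
`1/2`-cocoercive because `ρ ≤ 2`. Hence `L w` follows an accelerated Krasnosel'skiĭ–Mann iteration
for a nonexpansive map (`IsGenerated.isAccelerated`), and only its energy estimates are needed.

Put `a = α / 2 - 1`. For `a = 0` the iteration is Halpern's. The energy
`(k + 1) (k / 2 ‖r‖² - ⟨r, e⟩)` of the residual `r` and the momentum `e` is nonincreasing, which
gives `‖r‖ ≤ 2 ‖x₀ - p‖ / (k + 1)`, and the iterates converge to the projection of `x₀` onto the
fixed points. For `a > 0` a combination of this energy with the distance to a fixed point is a
Lyapunov function with dissipation `(k + 1) (‖δ‖² + ‖r‖²)`, `δ` being the step. The summability of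
the dissipation forces `e → 0` and `(k + 1) r → 0` and makes the distances to all fixed points
converge, so that Opial's argument applies.

Two facts transfer this back to the full space. By the positive definiteness assumptions the
subproblems are strongly monotone, so `w̄` is a Lipschitz function of `L w` in the norm and not only
in the seminorm (`IsProximalStep.exists_lipschitz`); thus convergence of `L w` yields convergence of
`w̄`, to a KKT point by closedness of the subdifferentials (`exists_tendsto_isKKT`). And the KKT
residual and the objective gap at `w̄` are bounded by multiples of `‖w - w̄‖_M`.
-/

noncomputable section

namespace AccPADMM

open Filter Topology

/-! ### Accelerated fixed-point sequences in a Hilbert space -/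

section Sequences

variable {H : Type*} [NormedAddCommGroup H] [InnerProductSpace ℝ H]

/-- The accelerated Krasnosel'skiĭ–Mann iteration for a nonexpansive map `T`, in the variables in
which its energy is a quadratic form: `x k` is the iterate, `r k = x k - T (x k)` the fixed-point
residual and `e k = k (x k - T (x (k - 1)))` the momentum. The map itself does not occur; its
nonexpansiveness is kept as the `1/2`-cocoercivity of `1 - T` along consecutive iterates. The
parameter is `a = α / 2 - 1`, so that `a = 0` is the Halpern iteration. -/
structure IsAccelerated (a : ℝ) (x r e : ℕ → H) : Prop where
  momentum_zero : e 0 = 0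
  step : ∀ k : ℕ, ((k : ℝ) + 2 * a + 2) • (x (k + 1) - x k) = e k - ((k : ℝ) + a + 1) • r k
  momentum_succ : ∀ k : ℕ, e (k + 1) = ((k : ℝ) + 1) • (x (k + 1) - x k + r k)
  cocoercive : ∀ k : ℕ,
    1 / 2 * ‖r (k + 1) - r k‖ ^ 2 ≤ inner ℝ (r (k + 1) - r k) (x (k + 1) - x k)

/-- The energy `(k + 1) (k / 2 ‖r‖² - ⟨r, e⟩)`, which is nonincreasing for the Halpern iteration. -/
def residualEnergy (r e : ℕ → H) (k : ℕ) : ℝ :=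
  ((k : ℝ) + 1) * ((k : ℝ) / 2 * ‖r k‖ ^ 2 - inner ℝ (r k) (e k))

/-- The energy measuring the distance to a fixed point `p`, up to the momentum. -/
def anchorEnergy (a : ℝ) (x e : ℕ → H) (p : H) (k : ℕ) : ℝ :=
  inner ℝ (x k - p) (e k) + (2 * a + 1) / 2 * ‖x k - p‖ ^ 2

namespace IsAccelerated

variable {a : ℝ} {x r e : ℕ → H}

theorem momentum_eq (h : IsAccelerated a x r e) (k : ℕ) :
    e k = ((k : ℝ) + 2 * a + 2) • (x (k + 1) - x k) + ((k : ℝ) + a + 1) • r k := by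
  rw [h.step k]; abel

theorem momentum_sub (h : IsAccelerated a x r e) (k : ℕ) :
    e (k + 1) = e k - (2 * a + 1) • (x (k + 1) - x k) - a • r k := by
  rw [h.momentum_eq k, h.momentum_succ k]; module

theorem residualEnergy_succ_le (h : IsAccelerated a x r e) (k : ℕ) :
    residualEnergy r e (k + 1) ≤ residualEnergy r e k
      + 2 * a * ((k : ℝ) + 1) * inner ℝ (r k) (x (k + 1) - x k)
      + a * ((k : ℝ) + 1) * ‖r k‖ ^ 2 := by
  have hc := h.cocoercive k
  have h1 := h.momentum_eq k
  have h2 := h.momentum_succ k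
  generalize hd : x (k + 1) - x k = d at *
  generalize hD : r (k + 1) - r k = D at *
  have hr : r (k + 1) = r k + D := by rw [← hD]; abel
  have key : residualEnergy r e (k + 1) = residualEnergy r e k
      + 2 * a * ((k : ℝ) + 1) * inner ℝ (r k) d + a * ((k : ℝ) + 1) * ‖r k‖ ^ 2
      - ((k : ℝ) + 1) * ((k : ℝ) + 2) * (inner ℝ D d - 1 / 2 * ‖D‖ ^ 2) := by
    unfold residualEnergy
    rw [hr, h2, h1]
    simp only [← real_inner_self_eq_norm_sq, inner_add_left, inner_add_right,
      inner_smul_right,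
      real_inner_comm (r k) D, Nat.cast_add, Nat.cast_one]
    rw [real_inner_comm D (r k)]
    ring
  rw [key]
  have : 0 ≤ ((k : ℝ) + 1) * ((k : ℝ) + 2) * (inner ℝ D d - 1 / 2 * ‖D‖ ^ 2) :=
    mul_nonneg (by positivity) (by linarith)
  linarith

theorem anchorEnergy_succ (h : IsAccelerated a x r e) (p : H) (k : ℕ) :
    anchorEnergy a x e p (k + 1) = anchorEnergy a x e p k - a * inner ℝ (r k) (x k - p)
      + ((k : ℝ) + 1 + (2 * a + 1) / 2) * ‖x (k + 1) - x k‖ ^ 2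
      + ((k : ℝ) + 1) * inner ℝ (r k) (x (k + 1) - x k) := by
  have h1 := h.momentum_eq k
  have h2 := h.momentum_succ k
  unfold anchorEnergy
  have hx : x (k + 1) - p = (x k - p) + (x (k + 1) - x k) := by abel
  rw [hx]
  generalize x (k + 1) - x k = d at *
  generalize x k - p = q at *
  rw [h2, h1]
  simp only [← real_inner_self_eq_norm_sq, inner_add_left, inner_add_right,
    inner_smul_right]
  rw [real_inner_comm q d, real_inner_comm (r k) q, real_inner_comm (r k) d]
  ring

theorem norm_momentum_succ_sq (h : IsAccelerated a x r e) (k : ℕ) :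
    1 / 2 * ‖e (k + 1)‖ ^ 2 = 1 / 2 * ‖e k‖ ^ 2
      - (2 * a + 1) * ((k : ℝ) + 1 + (2 * a + 1) / 2) * ‖x (k + 1) - x k‖ ^ 2
      - ((3 * a + 1) * ((k : ℝ) + 1) + a * (2 * a + 1)) * inner ℝ (r k) (x (k + 1) - x k)
      - a * ((k : ℝ) + 1 + a / 2) * ‖r k‖ ^ 2 := by
  rw [h.momentum_succ k, h.momentum_eq k]
  generalize x (k + 1) - x k = d at *
  simp only [← real_inner_self_eq_norm_sq, inner_add_left, inner_add_right, inner_smul_left,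
    inner_smul_right, RCLike.conj_to_real]
  rw [real_inner_comm (r k) d]
  ring

/-! ### The Halpern iteration (`a = 0`) -/

theorem momentum_eq_sub (h : IsAccelerated 0 x r e) (k : ℕ) : e k = x 0 - x k := by
  induction k with
  | zero => simp [h.momentum_zero]
  | succ k ih => rw [h.momentum_sub, ih]; module

/-- For `a = 0` the energy is nonincreasing and starts at `0`, so `(k + 1) / 2 ‖r‖² ≤ ⟨r, x₀ - p⟩`
at every fixed point `p`. -/
theorem norm_residual_le (h : IsAccelerated 0 x r e) {p : H}
    (hp : ∀ k, 1 / 2 * ‖r k‖ ^ 2 ≤ inner ℝ (r k) (x k - p)) (k : ℕ) :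
    ‖r k‖ ≤ 2 * ‖x 0 - p‖ / ((k : ℝ) + 1) := by
  have hG : residualEnergy r e k ≤ 0 := by
    induction k with
    | zero => simp [residualEnergy, h.momentum_zero]
    | succ k ih => have := h.residualEnergy_succ_le k; simp at this; linarith
  have hk : (0 : ℝ) < (k : ℝ) + 1 := by positivity
  have h1 : (k : ℝ) / 2 * ‖r k‖ ^ 2 - inner ℝ (r k) (e k) ≤ 0 :=
    nonpos_of_mul_nonpos_right hG hk
  have h2 : inner ℝ (r k) (e k) + inner ℝ (r k) (x k - p) = inner ℝ (r k) (x 0 - p) := by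
    rw [← inner_add_right, h.momentum_eq_sub k]; congr 1; abel
  have h3 := real_inner_le_norm (r k) (x 0 - p)
  have h4 := hp k
  rw [le_div_iff₀ hk]
  rcases (norm_nonneg (r k)).eq_or_lt with h0 | h0
  · rw [← h0]; simp
  · nlinarith [h0]

theorem smul_succ_sub (h : IsAccelerated 0 x r e) (p : H) (k : ℕ) :
    ((k : ℝ) + 2) • (x (k + 1) - p) = (x 0 - p) + ((k : ℝ) + 1) • (x k - r k - p) := by
  have h1 := h.momentum_succ k
  rw [h.momentum_eq_sub] at h1
  rw [← sub_eq_zero] at h1 ⊢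
  rw [← neg_eq_zero, ← h1]
  module

/-- The image of an iterate is no farther from a fixed point than the iterate. -/
theorem norm_image_sub_le {u v p : H} (hp : 1 / 2 * ‖v‖ ^ 2 ≤ inner ℝ v (u - p)) :
    ‖u - v - p‖ ≤ ‖u - p‖ := by
  have : ‖u - v - p‖ ^ 2 ≤ ‖u - p‖ ^ 2 := by
    rw [show u - v - p = (u - p) - v by abel, norm_sub_sq_real, real_inner_comm]
    linarith
  exact (sq_le_sq₀ (norm_nonneg _) (norm_nonneg _)).1 this

theorem norm_sub_le_norm_zero_sub (h : IsAccelerated 0 x r e) {p : H}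
    (hp : ∀ k, 1 / 2 * ‖r k‖ ^ 2 ≤ inner ℝ (r k) (x k - p)) (k : ℕ) :
    ‖x k - p‖ ≤ ‖x 0 - p‖ := by
  induction k with
  | zero => rfl
  | succ k ih =>
    have h1 := congrArg norm (h.smul_succ_sub p k)
    rw [norm_smul, Real.norm_of_nonneg (by positivity)] at h1
    have h2 := norm_add_le (x 0 - p) (((k : ℝ) + 1) • (x k - r k - p))
    rw [norm_smul, Real.norm_of_nonneg (by positivity), ← h1] at h2
    have h3 := (norm_image_sub_le (hp k)).trans ih
    have hk : (0 : ℝ) ≤ (k : ℝ) := by positivity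
    nlinarith

theorem weighted_norm_sq_succ_le (h : IsAccelerated 0 x r e) {p : H}
    (hp : ∀ k, 1 / 2 * ‖r k‖ ^ 2 ≤ inner ℝ (r k) (x k - p)) (k : ℕ) :
    ((k : ℝ) + 2) * ‖x (k + 1) - p‖ ^ 2 ≤
      ((k : ℝ) + 1) * ‖x k - p‖ ^ 2 + 2 * inner ℝ (x 0 - p) (x (k + 1) - p) := by
  have h1 := h.smul_succ_sub p k
  have h3 := norm_image_sub_le (hp k)
  generalize x k - r k - p = t at *
  generalize x (k + 1) - p = y at *
  generalize x 0 - p = z at *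
  have h4 : ((k : ℝ) + 1) • t = ((k : ℝ) + 2) • y - z := by rw [h1]; abel
  have h5 := congrArg (fun v => ‖v‖ ^ 2) h4
  simp only [norm_sub_sq_real, norm_smul, Real.norm_eq_abs, mul_pow, sq_abs,
    inner_smul_left, RCLike.conj_to_real] at h5
  rw [real_inner_comm] at h5
  have h6 : ‖t‖ ^ 2 ≤ ‖x k - p‖ ^ 2 := by gcongr
  have hk : (0 : ℝ) ≤ (k : ℝ) := by positivity
  have h7 : 0 ≤ ‖z‖ ^ 2 := by positivity
  have h8 : ((k : ℝ) + 2) * (((k : ℝ) + 2) * ‖y‖ ^ 2) ≤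
      ((k : ℝ) + 2) * (((k : ℝ) + 1) * ‖x k - p‖ ^ 2 + 2 * inner ℝ z y) := by
    have : ((k : ℝ) + 1) ^ 2 * ‖t‖ ^ 2 ≤ ((k : ℝ) + 2) * (((k : ℝ) + 1) * ‖x k - p‖ ^ 2) := by
      calc ((k : ℝ) + 1) ^ 2 * ‖t‖ ^ 2 ≤ (((k : ℝ) + 2) * ((k : ℝ) + 1)) * ‖x k - p‖ ^ 2 := by
            gcongr; nlinarith
        _ = _ := by ring
    nlinarith
  exact le_of_mul_le_mul_left h8 (by positivity)

theorem tendsto_residual_of_zero (h : IsAccelerated 0 x r e) {p : H}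
    (hp : ∀ k, 1 / 2 * ‖r k‖ ^ 2 ≤ inner ℝ (r k) (x k - p)) : Tendsto r atTop (𝓝 0) := by
  refine squeeze_zero_norm (h.norm_residual_le hp) ?_
  simpa [div_eq_mul_inv] using
    (tendsto_one_div_add_atTop_nhds_zero_nat (𝕜 := ℝ)).const_mul (2 * ‖x 0 - p‖)

/-- The Halpern iteration converges to the projection of the starting point onto the closed convex
set `P` of fixed points, provided that cluster points of the iterates lie in `P`. -/
theorem exists_tendsto_of_zero [FiniteDimensional ℝ H] (h : IsAccelerated 0 x r e) {P : Set H}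
    (hne : P.Nonempty) (hclosed : IsClosed P) (hconv : Convex ℝ P)
    (hp : ∀ p ∈ P, ∀ k, 1 / 2 * ‖r k‖ ^ 2 ≤ inner ℝ (r k) (x k - p))
    (hcl : ∀ φ : ℕ → ℕ, StrictMono φ → ∀ q, Tendsto (x ∘ φ) atTop (𝓝 q) →
      Tendsto (r ∘ φ) atTop (𝓝 0) → q ∈ P) :
    ∃ p ∈ P, Tendsto x atTop (𝓝 p) := by
  obtain ⟨p, hpP, hmin⟩ := exists_norm_eq_iInf_of_complete_convex hne hclosed.isComplete hconv (x 0)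
  have hproj := (norm_eq_iInf_iff_real_inner_le_zero hconv hpP).1 hmin
  refine ⟨p, hpP, ?_⟩
  have hr : Tendsto r atTop (𝓝 0) := h.tendsto_residual_of_zero (hp p hpP)
  have hbdd : ∀ k, x k ∈ Metric.closedBall p ‖x 0 - p‖ := fun k => by
    rw [mem_closedBall_iff_norm]; exact h.norm_sub_le_norm_zero_sub (hp p hpP) k
  -- every cluster point lies in `P`, hence on the far side of the supporting hyperplane at `p`
  have hβ : Tendsto (fun k => max (inner ℝ (x 0 - p) (x k - p)) 0) atTop (𝓝 0) := by
    refine tendsto_of_subseq_tendsto fun ns hns => ?_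
    obtain ⟨ψ, -, hψ⟩ := strictMono_subseq_of_tendsto_atTop hns
    obtain ⟨q, -, φ, hφ, hq⟩ := (isCompact_closedBall p ‖x 0 - p‖).tendsto_subseq
      (fun k => hbdd (ns (ψ k)))
    have hsm : StrictMono (ns ∘ ψ ∘ φ) := hψ.comp hφ
    have hqP : q ∈ P := hcl _ hsm q hq (hr.comp hsm.tendsto_atTop)
    refine ⟨ψ ∘ φ, ?_⟩
    have h1 : Tendsto (fun k => max (inner ℝ (x 0 - p) (x (ns (ψ (φ k))) - p)) 0) atTop
        (𝓝 (max (inner ℝ (x 0 - p) (q - p)) 0)) := by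
      have : Tendsto (fun k => x (ns (ψ (φ k)))) atTop (𝓝 q) := hq
      exact ((tendsto_const_nhds.inner (this.sub_const p)).max tendsto_const_nhds)
    rwa [max_eq_right (hproj q hqP)] at h1
  have hsum : ∀ k : ℕ, ((k : ℝ) + 1) * ‖x k - p‖ ^ 2 ≤ ‖x 0 - p‖ ^ 2 +
      2 * ∑ j ∈ Finset.range k, max (inner ℝ (x 0 - p) (x (j + 1) - p)) 0 := by
    intro k
    induction k with
    | zero => simp
    | succ k ih =>
      have h1 := h.weighted_norm_sq_succ_le (hp p hpP) k
      have h2 := le_max_left (inner ℝ (x 0 - p) (x (k + 1) - p)) 0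
      rw [Finset.sum_range_succ]
      push_cast
      linarith
  have hces := ((tendsto_add_atTop_iff_nat 1).2 hβ).cesaro
  have hsq : Tendsto (fun k => ‖x k - p‖ ^ 2) atTop (𝓝 0) := by
    have hlim : Tendsto (fun k : ℕ => ‖x 0 - p‖ ^ 2 * (1 / ((k : ℝ) + 1)) + 2 * ((k : ℝ)⁻¹ *
        ∑ j ∈ Finset.range k, max (inner ℝ (x 0 - p) (x (j + 1) - p)) 0)) atTop (𝓝 0) := by
      have := ((tendsto_one_div_add_atTop_nhds_zero_nat (𝕜 := ℝ)).const_mul (‖x 0 - p‖ ^ 2)).add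
        (hces.const_mul 2)
      simpa using this
    refine squeeze_zero' (Eventually.of_forall fun k => by positivity) ?_ hlim
    filter_upwards [eventually_gt_atTop 0] with k hk
    have hk' : (0 : ℝ) < k := by exact_mod_cast hk
    have hS : 0 ≤ ∑ j ∈ Finset.range k, max (inner ℝ (x 0 - p) (x (j + 1) - p)) 0 :=
      Finset.sum_nonneg fun _ _ => le_max_right _ _
    have h1 : ‖x k - p‖ ^ 2 ≤ (‖x 0 - p‖ ^ 2 + 2 * ∑ j ∈ Finset.range k,
        max (inner ℝ (x 0 - p) (x (j + 1) - p)) 0) / ((k : ℝ) + 1) := by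
      rw [le_div_iff₀ (by positivity)]; linarith [hsum k]
    refine h1.trans ?_
    rw [add_div, div_eq_mul_one_div (‖x 0 - p‖ ^ 2)]
    refine add_le_add le_rfl ?_
    rw [mul_div_assoc, ← div_eq_inv_mul]
    gcongr
    linarith
  rw [tendsto_iff_norm_sub_tendsto_zero]
  have := hsq.sqrt
  simpa using this

end IsAccelerated

end Sequences

/-! ### The accelerated iteration with `a > 0` -/

/-- A sequence that eventually decreases by at least `d k ≥ 0` in each step and is bounded below
converges, and its decrements are summable. -/
theorem summable_and_tendsto_of_descent {F d : ℕ → ℝ} {K : ℕ} (hF : ∀ k, 0 ≤ F k)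
    (hd : ∀ k, 0 ≤ d k) (h : ∀ k, K ≤ k → F (k + 1) + d k ≤ F k) :
    Summable d ∧ ∃ l, Tendsto F atTop (𝓝 l) := by
  constructor
  · rw [← summable_nat_add_iff K]
    refine summable_of_sum_range_le (c := F K) (fun k => hd _) fun n => ?_
    have : ∑ i ∈ Finset.range n, d (i + K) ≤ F K - F (n + K) := by
      induction n with
      | zero => simp
      | succ n ih =>
        rw [Finset.sum_range_succ]
        have := h (n + K) (by omega)
        rw [show n + 1 + K = n + K + 1 by omega]
        linarith
    linarith [hF (n + K)]
  · have hanti : Antitone fun k => F (k + K) := antitone_nat_of_succ_le fun k => by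
      have := h (k + K) (by omega)
      rw [show k + 1 + K = k + K + 1 by omega]
      linarith [hd (k + K)]
    have hb : BddBelow (Set.range fun k => F (k + K)) := ⟨0, by rintro _ ⟨k, rfl⟩; exact hF _⟩
    exact ⟨_, (tendsto_add_atTop_iff_nat K).1 (tendsto_atTop_ciInf hanti hb)⟩

theorem exists_tendsto_of_summable_sub {U : ℕ → ℝ} (h : Summable fun k => U (k + 1) - U k) :
    ∃ l, Tendsto U atTop (𝓝 l) := by
  obtain ⟨s, hs⟩ := h
  refine ⟨s + U 0, ?_⟩
  have := hs.tendsto_sum_nat.add_const (U 0)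
  simp only [Finset.sum_range_sub, sub_add_cancel] at this
  exact this

/-- A convergent nonnegative sequence that is summable against `1 / (k + 1)` tends to `0`. -/
theorem eq_zero_of_summable_div {Q : ℕ → ℝ} {l : ℝ} (hQ : ∀ k, 0 ≤ Q k)
    (hl : Tendsto Q atTop (𝓝 l)) (hs : Summable fun k : ℕ => Q k / ((k : ℝ) + 1)) : l = 0 := by
  by_contra hne
  have hpos : 0 < l := lt_of_le_of_ne (ge_of_tendsto' hl hQ) (Ne.symm hne)
  obtain ⟨K, hK⟩ := eventually_atTop.1 (hl.eventually (lt_mem_nhds (half_lt_self hpos)))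
  have h1 : Summable fun k : ℕ => l / 2 / (((k + K : ℕ) : ℝ) + 1) := by
    refine Summable.of_nonneg_of_le (fun k => by positivity) (fun k => ?_)
      ((summable_nat_add_iff K).2 hs)
    have := hK (k + K) (by omega)
    gcongr
  have h2 : Summable fun k : ℕ => 1 / (((k : ℕ) : ℝ) + 1) := by
    have := ((summable_nat_add_iff (f := fun k : ℕ => l / 2 / ((k : ℝ) + 1)) K).1 h1).mul_left
      (2 / l)
    refine this.congr fun k => ?_
    field_simp
  have h3 : Summable fun k : ℕ => 1 / ((k : ℝ)) := by
    rw [← summable_nat_add_iff 1]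
    simpa using h2
  exact Real.not_summable_one_div_natCast h3

namespace IsAccelerated

variable {H : Type*} [NormedAddCommGroup H] [InnerProductSpace ℝ H]
variable {a : ℝ} {x r e : ℕ → H}

/-- The Lyapunov function of the accelerated iteration with `a > 0`. -/
def lyapunov (a : ℝ) (x r e : ℕ → H) (p : H) (k : ℕ) : ℝ :=
  (a + 1) * anchorEnergy a x e p k + 1 / 2 * ‖e k‖ ^ 2 + 1 / 2 * residualEnergy r e k

/-- The Lyapunov function is nonnegative and bounds the distance to `p`: with
`A = (a + 1) (x - p) + e` it is at least
`¼ ‖A‖² + ¼ ‖A - (k + 1) r‖² + ½ a (a + 1) ‖x - p‖²`. -/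
theorem norm_sub_sq_le_lyapunov (ha : 0 ≤ a) {p : H} {k : ℕ}
    (hp : 1 / 2 * ‖r k‖ ^ 2 ≤ inner ℝ (r k) (x k - p)) :
    (a + 1) * a / 2 * ‖x k - p‖ ^ 2 ≤ lyapunov a x r e p k := by
  unfold lyapunov anchorEnergy residualEnergy
  generalize x k - p = q at *
  have h1 : 0 ≤ ‖(a + 1) • q + e k‖ ^ 2 := by positivity
  have h2 : 0 ≤ ‖(a + 1) • q + e k - ((k : ℝ) + 1) • r k‖ ^ 2 := by positivity
  have h3 : 0 ≤ a * ((k : ℝ) + 1) * inner ℝ (r k) q :=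
    mul_nonneg (by positivity) (le_trans (by positivity) hp)
  have h4 : 0 ≤ ((k : ℝ) + 1) * (inner ℝ (r k) q - 1 / 2 * ‖r k‖ ^ 2) :=
    mul_nonneg (by positivity) (by linarith)
  simp only [← real_inner_self_eq_norm_sq, inner_add_left, inner_add_right, inner_smul_left,
    inner_smul_right, inner_sub_left, inner_sub_right, RCLike.conj_to_real] at *
  rw [real_inner_comm q (e k), real_inner_comm (r k) q, real_inner_comm (r k) (e k)] at *
  linarith

/-- For large `k` the Lyapunov function decreases by a multiple of `(k + 1) (‖δ‖² + ‖r‖²)`, where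
`δ` is the step: the quadratic form `‖δ‖² + ⟨r, δ⟩ + ½ ‖r‖²` is positive definite and dominates
the terms of lower order in `k`. -/
theorem lyapunov_succ_add_le (h : IsAccelerated a x r e) (ha : 0 ≤ a) {p : H} {k : ℕ}
    (hk : 8 * (2 * a + 1) ≤ (k : ℝ) + 1) :
    lyapunov a x r e p (k + 1) + ((a + 1) * a * inner ℝ (r k) (x k - p)
      + a / 16 * (((k : ℝ) + 1) * (‖x (k + 1) - x k‖ ^ 2 + ‖r k‖ ^ 2))) ≤
    lyapunov a x r e p k := by
  have h1 := h.residualEnergy_succ_le k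
  unfold lyapunov
  rw [h.anchorEnergy_succ p k, h.norm_momentum_succ_sq k]
  generalize x (k + 1) - x k = d at *
  have h2 : 0 ≤ ‖d + (2 / 3 : ℝ) • r k‖ ^ 2 := by positivity
  have h3 : 0 ≤ ‖d + r k‖ ^ 2 := by positivity
  rw [norm_add_sq_real, norm_smul, inner_smul_right, mul_pow, real_inner_comm] at h2
  rw [norm_add_sq_real, real_inner_comm] at h3
  norm_num at h2
  have hd : 0 ≤ ‖d‖ ^ 2 := by positivity
  have hr : 0 ≤ ‖r k‖ ^ 2 := by positivity
  generalize ‖d‖ ^ 2 = D at *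
  generalize ‖r k‖ ^ 2 = R at *
  generalize inner ℝ (r k) d = I at *
  generalize (k : ℝ) + 1 = n at *
  have hn : 0 ≤ n := by linarith
  have h4 : n * (1 / 8 * (D + R)) ≤ n * (D + I + 1 / 2 * R) :=
    mul_le_mul_of_nonneg_left (by linarith) hn
  have h5 : (2 * a + 1) * (-(1 / 2) * (D + R)) ≤ (2 * a + 1) * I :=
    mul_le_mul_of_nonneg_left (by linarith) (by linarith)
  have h6 : 8 * (2 * a + 1) * (D + R) ≤ n * (D + R) :=
    mul_le_mul_of_nonneg_right hk (by linarith)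
  have h7 : 0 ≤ a * D := mul_nonneg ha hd
  have h8 : 0 ≤ a * R := mul_nonneg ha hr
  have h9 : n / 16 * (D + R) ≤
      (n + (2 * a + 1) / 2) * D + (n + (2 * a + 1)) * I + 1 / 2 * (n + a) * R := by
    linarith
  have h10 := mul_le_mul_of_nonneg_left h9 ha
  linarith

theorem norm_add_smul_sq_le {s t c n : ℝ} (hn : 1 ≤ n) (hs : |s| ≤ c * n)
    (ht : |t| ≤ c * n) (d v : H) :
    ‖s • d + t • v‖ ^ 2 ≤ n * (2 * c ^ 2 * (n * (‖d‖ ^ 2 + ‖v‖ ^ 2))) := by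
  have h1 : ‖s • d + t • v‖ ≤ c * n * (‖d‖ + ‖v‖) := by
    refine (norm_add_le _ _).trans ?_
    rw [norm_smul, norm_smul, mul_add]
    simp only [Real.norm_eq_abs]
    gcongr
  calc ‖s • d + t • v‖ ^ 2 ≤ (c * n * (‖d‖ + ‖v‖)) ^ 2 := by gcongr
    _ = c ^ 2 * n ^ 2 * (‖d‖ + ‖v‖) ^ 2 := by ring
    _ ≤ c ^ 2 * n ^ 2 * (2 * (‖d‖ ^ 2 + ‖v‖ ^ 2)) := by
        gcongr
        exact add_sq_le
    _ = _ := by ring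

/-- Consequences of the Lyapunov descent: the dissipation is summable and the energies converge. The
anchor energy converges because its increments are summable. -/
theorem summable_and_exists_tendsto (h : IsAccelerated a x r e) (ha : 0 < a) {p : H}
    (hp : ∀ k, 1 / 2 * ‖r k‖ ^ 2 ≤ inner ℝ (r k) (x k - p)) :
    (Summable fun k : ℕ => ((k : ℝ) + 1) * (‖x (k + 1) - x k‖ ^ 2 + ‖r k‖ ^ 2)) ∧
    (∃ l, Tendsto (lyapunov a x r e p) atTop (𝓝 l)) ∧
    ∃ l, Tendsto (anchorEnergy a x e p) atTop (𝓝 l) := by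
  obtain ⟨K, hK⟩ := exists_nat_ge (8 * (2 * a + 1))
  have hip : ∀ k, 0 ≤ inner ℝ (r k) (x k - p) := fun k => le_trans (by positivity) (hp k)
  have h1 := summable_and_tendsto_of_descent (F := lyapunov a x r e p) (K := K)
    (d := fun k => (a + 1) * a * inner ℝ (r k) (x k - p)
      + a / 16 * (((k : ℝ) + 1) * (‖x (k + 1) - x k‖ ^ 2 + ‖r k‖ ^ 2)))
    (fun k => le_trans (by positivity) (norm_sub_sq_le_lyapunov ha.le (hp k)))
    (fun k => add_nonneg (mul_nonneg (by positivity) (hip k)) (by positivity))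
    (fun k hk => h.lyapunov_succ_add_le ha.le (by
      have : (K : ℝ) ≤ k := by exact_mod_cast hk
      linarith))
  obtain ⟨hs, hF⟩ := h1
  have hs1 : Summable fun k : ℕ => ((k : ℝ) + 1) * (‖x (k + 1) - x k‖ ^ 2 + ‖r k‖ ^ 2) := by
    have : Summable fun k : ℕ =>
        a / 16 * (((k : ℝ) + 1) * (‖x (k + 1) - x k‖ ^ 2 + ‖r k‖ ^ 2)) :=
      Summable.of_nonneg_of_le (fun k => by positivity)
        (fun k => le_add_of_nonneg_left (mul_nonneg (by positivity) (hip k))) hs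
    exact (summable_mul_left_iff (by positivity)).1 this
  have hs2 : Summable fun k : ℕ => inner ℝ (r k) (x k - p) := by
    have : Summable fun k : ℕ => (a + 1) * a * inner ℝ (r k) (x k - p) :=
      Summable.of_nonneg_of_le (fun k => mul_nonneg (by positivity) (hip k))
        (fun k => le_add_of_nonneg_right (by positivity)) hs
    exact (summable_mul_left_iff (by positivity)).1 this
  refine ⟨hs1, hF, exists_tendsto_of_summable_sub ?_⟩
  refine Summable.of_norm_bounded ((hs2.mul_left a).add (hs1.mul_left (2 * a + 3))) fun k => ?_
  rw [h.anchorEnergy_succ p k, Real.norm_eq_abs]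
  have hI := abs_le.1 (abs_real_inner_le_norm (r k) (x (k + 1) - x k))
  have hi := hip k
  generalize ‖x (k + 1) - x k‖ = D at *
  generalize ‖r k‖ = R at *
  generalize inner ℝ (r k) (x (k + 1) - x k) = I at *
  have hn : (1 : ℝ) ≤ (k : ℝ) + 1 := le_add_of_nonneg_left k.cast_nonneg
  generalize (k : ℝ) + 1 = n at *
  have hI1 : |I| ≤ D ^ 2 + R ^ 2 := abs_le.2 ⟨by nlinarith, by nlinarith⟩
  have h1 : |n * I| ≤ n * (D ^ 2 + R ^ 2) := by
    rw [abs_mul, abs_of_nonneg (by linarith : 0 ≤ n)]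
    gcongr
  have h2 : (n + (2 * a + 1) / 2) * D ^ 2 ≤ (2 * a + 2) * (n * (D ^ 2 + R ^ 2)) := by
    have : n + (2 * a + 1) / 2 ≤ (2 * a + 2) * n := by nlinarith
    calc (n + (2 * a + 1) / 2) * D ^ 2 ≤ ((2 * a + 2) * n) * (D ^ 2 + R ^ 2) := by
          gcongr
          nlinarith [sq_nonneg R]
      _ = _ := by ring
  have h3 : 0 ≤ (n + (2 * a + 1) / 2) * D ^ 2 := by positivity
  have h4 : 0 ≤ a * inner ℝ (r k) (x k - p) := mul_nonneg ha.le hi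
  have h5 : 0 ≤ (2 * a + 2) * (n * (D ^ 2 + R ^ 2)) := by positivity
  rw [abs_le] at h1 ⊢
  constructor <;> linarith [h1.1, h1.2]

/-- The momentum `e` and the scaled residual `(k + 1) r` vanish in the limit: the limit of
`¼ ‖e‖² + ¼ ‖e - (k + 1) r‖²` exists, and this quantity is summable against `1 / (k + 1)`. -/
theorem tendsto_momentum_and_residual (h : IsAccelerated a x r e) (ha : 0 < a) {p : H}
    (hp : ∀ k, 1 / 2 * ‖r k‖ ^ 2 ≤ inner ℝ (r k) (x k - p)) :
    Tendsto e atTop (𝓝 0) ∧ Tendsto (fun k : ℕ => ((k : ℝ) + 1) • r k) atTop (𝓝 0) := by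
  obtain ⟨hs, ⟨lF, hF⟩, ⟨lU, hU⟩⟩ := h.summable_and_exists_tendsto ha hp
  set S : ℕ → ℝ := fun k => ((k : ℝ) + 1) * (‖x (k + 1) - x k‖ ^ 2 + ‖r k‖ ^ 2) with hS
  have hnr : Tendsto (fun k : ℕ => ((k : ℝ) + 1) * ‖r k‖ ^ 2) atTop (𝓝 0) := by
    refine squeeze_zero (fun k => by positivity) (fun k => ?_) hs.tendsto_atTop_zero
    simp only [hS]
    gcongr
    linarith [sq_nonneg ‖x (k + 1) - x k‖]
  set Q : ℕ → ℝ := fun k => 1 / 4 * ‖e k‖ ^ 2 + 1 / 4 * ‖e k - ((k : ℝ) + 1) • r k‖ ^ 2 with hQdef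
  have hQ : Tendsto Q atTop (𝓝 (lF - (a + 1) * lU + 1 / 4 * 0)) := by
    refine ((hF.sub (hU.const_mul (a + 1))).add (hnr.const_mul (1 / 4))).congr fun k => ?_
    simp only [hQdef, lyapunov, residualEnergy]
    rw [norm_sub_sq_real, norm_smul, inner_smul_right, mul_pow, real_inner_comm,
      Real.norm_eq_abs, sq_abs]
    ring
  have hn : ∀ k : ℕ, (1 : ℝ) ≤ (k : ℝ) + 1 := fun k => by
    have : (0 : ℝ) ≤ k := by positivity
    linarith
  have hQn : ∀ k, 0 ≤ Q k := fun k => by positivity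
  have hzero := eq_zero_of_summable_div hQn hQ (by
    refine Summable.of_nonneg_of_le (fun k => by positivity) (fun k => ?_)
      (hs.mul_left ((2 * a + 2) ^ 2))
    have hk := hn k
    have hk0 : (0 : ℝ) < (k : ℝ) + 1 := by positivity
    rw [div_le_iff₀ hk0]
    have e1 : e k = ((k : ℝ) + 2 * a + 2) • (x (k + 1) - x k) + ((k : ℝ) + a + 1) • r k :=
      h.momentum_eq k
    have e2 : e k - ((k : ℝ) + 1) • r k =
        ((k : ℝ) + 2 * a + 2) • (x (k + 1) - x k) + a • r k := by rw [e1]; module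
    have hb1 : |(k : ℝ) + 2 * a + 2| ≤ (2 * a + 2) * ((k : ℝ) + 1) := by
      rw [abs_of_nonneg (by positivity)]; nlinarith
    have hb2 : |(k : ℝ) + a + 1| ≤ (2 * a + 2) * ((k : ℝ) + 1) := by
      rw [abs_of_nonneg (by positivity)]; nlinarith
    have hb3 : |a| ≤ (2 * a + 2) * ((k : ℝ) + 1) := by
      rw [abs_of_nonneg (by positivity)]; nlinarith
    have q1 := norm_add_smul_sq_le hk hb1 hb2 (x (k + 1) - x k) (r k)
    have q2 := norm_add_smul_sq_le hk hb1 hb3 (x (k + 1) - x k) (r k)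
    rw [← e1] at q1
    rw [← e2] at q2
    simp only [hQdef, hS]
    linarith)
  rw [hzero] at hQ
  have hb1 : ∀ k, ‖e k‖ ^ 2 ≤ 4 * Q k := fun k => by
    have : 0 ≤ ‖e k - ((k : ℝ) + 1) • r k‖ ^ 2 := by positivity
    simp only [hQdef]; linarith
  have hb2 : ∀ k : ℕ, ‖e k - ((k : ℝ) + 1) • r k‖ ^ 2 ≤ 4 * Q k := fun k => by
    have : 0 ≤ ‖e k‖ ^ 2 := by positivity
    simp only [hQdef]; linarith
  have he : Tendsto e atTop (𝓝 0) := by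
    rw [tendsto_zero_iff_norm_tendsto_zero]
    have : Tendsto (fun k => ‖e k‖ ^ 2) atTop (𝓝 0) :=
      squeeze_zero (fun k => by positivity)
        hb1
        (by simpa using hQ.const_mul 4)
    simpa using this.sqrt
  have he2 : Tendsto (fun k : ℕ => e k - ((k : ℝ) + 1) • r k) atTop (𝓝 0) := by
    rw [tendsto_zero_iff_norm_tendsto_zero]
    have : Tendsto (fun k : ℕ => ‖e k - ((k : ℝ) + 1) • r k‖ ^ 2) atTop (𝓝 0) :=
      squeeze_zero (fun k => by positivity)
        hb2
        (by simpa using hQ.const_mul 4)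
    simpa using this.sqrt
  refine ⟨he, ?_⟩
  simpa using he.sub he2

theorem exists_norm_sub_le (h : IsAccelerated a x r e) (ha : 0 < a) {p : H}
    (hp : ∀ k, 1 / 2 * ‖r k‖ ^ 2 ≤ inner ℝ (r k) (x k - p)) : ∃ R, ∀ k, ‖x k - p‖ ≤ R := by
  obtain ⟨-, ⟨lF, hF⟩, -⟩ := h.summable_and_exists_tendsto ha hp
  obtain ⟨R, hR⟩ := hF.bddAbove_range
  refine ⟨√(R / ((a + 1) * a / 2)), fun k => Real.le_sqrt_of_sq_le ?_⟩
  rw [le_div_iff₀ (by positivity), mul_comm]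
  exact (norm_sub_sq_le_lyapunov ha.le (hp k)).trans (hR ⟨k, rfl⟩)

/-- As the momentum vanishes, the anchor energy is asymptotically a multiple of `‖x - p‖²`. -/
theorem tendsto_norm_sub (h : IsAccelerated a x r e) (ha : 0 < a) {p : H}
    (hp : ∀ k, 1 / 2 * ‖r k‖ ^ 2 ≤ inner ℝ (r k) (x k - p)) :
    ∃ l, Tendsto (fun k => ‖x k - p‖) atTop (𝓝 l) := by
  obtain ⟨-, -, ⟨lU, hU⟩⟩ := h.summable_and_exists_tendsto ha hp
  obtain ⟨he, -⟩ := h.tendsto_momentum_and_residual ha hp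
  obtain ⟨R, hR⟩ := h.exists_norm_sub_le ha hp
  have h1 : Tendsto (fun k => inner ℝ (x k - p) (e k)) atTop (𝓝 0) := by
    refine squeeze_zero_norm (a := fun k => R * ‖e k‖) (fun k => ?_) ?_
    · exact (norm_inner_le_norm _ _).trans (by gcongr; exact hR k)
    · simpa using he.norm.const_mul R
  refine ⟨√(2 / (2 * a + 1) * (lU - 0)), ?_⟩
  refine (((hU.sub h1).const_mul (2 / (2 * a + 1))).sqrt).congr fun k => ?_
  rw [anchorEnergy, add_sub_cancel_left, ← mul_assoc]
  rw [show 2 / (2 * a + 1) * ((2 * a + 1) / 2) = 1 by field_simp, one_mul,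
    Real.sqrt_sq (norm_nonneg _)]

theorem tendsto_residual (h : IsAccelerated a x r e) (ha : 0 ≤ a) {p : H}
    (hp : ∀ k, 1 / 2 * ‖r k‖ ^ 2 ≤ inner ℝ (r k) (x k - p)) : Tendsto r atTop (𝓝 0) := by
  rcases ha.eq_or_lt with rfl | ha
  · exact h.tendsto_residual_of_zero hp
  have h1 := (h.tendsto_momentum_and_residual ha hp).2
  have h2 := (tendsto_one_div_add_atTop_nhds_zero_nat (𝕜 := ℝ)).smul h1
  rw [zero_smul] at h2
  refine h2.congr fun k => ?_
  rw [smul_smul, one_div_mul_cancel (by positivity), one_smul]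

/-- Opial's argument: the distances to all fixed points converge and every cluster point is a fixed
point. -/
theorem exists_tendsto_of_pos [FiniteDimensional ℝ H] (h : IsAccelerated a x r e) (ha : 0 < a)
    {P : Set H} (hne : P.Nonempty)
    (hp : ∀ p ∈ P, ∀ k, 1 / 2 * ‖r k‖ ^ 2 ≤ inner ℝ (r k) (x k - p))
    (hcl : ∀ φ : ℕ → ℕ, StrictMono φ → ∀ q, Tendsto (x ∘ φ) atTop (𝓝 q) →
      Tendsto (r ∘ φ) atTop (𝓝 0) → q ∈ P) :
    ∃ p ∈ P, Tendsto x atTop (𝓝 p) := by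
  obtain ⟨p₀, hp₀⟩ := hne
  obtain ⟨R, hR⟩ := h.exists_norm_sub_le ha (hp p₀ hp₀)
  have hr : Tendsto r atTop (𝓝 0) := h.tendsto_residual ha.le (hp p₀ hp₀)
  obtain ⟨q, -, φ, hφ, hq⟩ := (isCompact_closedBall p₀ R).tendsto_subseq
    (fun k => (mem_closedBall_iff_norm.2 (hR k) : x k ∈ _))
  have hqP := hcl φ hφ q hq (hr.comp hφ.tendsto_atTop)
  obtain ⟨l, hl⟩ := h.tendsto_norm_sub ha (hp q hqP)
  have hl0 : l = 0 := by
    refine tendsto_nhds_unique (hl.comp hφ.tendsto_atTop) ?_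
    exact tendsto_iff_norm_sub_tendsto_zero.1 hq
  exact ⟨q, hqP, tendsto_iff_norm_sub_tendsto_zero.2 (hl0 ▸ hl)⟩

theorem exists_tendsto [FiniteDimensional ℝ H] (h : IsAccelerated a x r e) (ha : 0 ≤ a)
    {P : Set H} (hne : P.Nonempty) (hclosed : IsClosed P) (hconv : Convex ℝ P)
    (hp : ∀ p ∈ P, ∀ k, 1 / 2 * ‖r k‖ ^ 2 ≤ inner ℝ (r k) (x k - p))
    (hcl : ∀ φ : ℕ → ℕ, StrictMono φ → ∀ q, Tendsto (x ∘ φ) atTop (𝓝 q) →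
      Tendsto (r ∘ φ) atTop (𝓝 0) → q ∈ P) :
    ∃ p ∈ P, Tendsto x atTop (𝓝 p) := by
  rcases ha.eq_or_lt with rfl | ha
  · exact h.exists_tendsto_of_zero hne hclosed hconv hp hcl
  · exact h.exists_tendsto_of_pos ha hne hp hcl

end IsAccelerated

/-! ### Subgradients and proximal mappings -/

section ConvexAnalysis

theorem eq_top_of_notMem_effDom {E : Type*} {f : E → EReal} {y : E} (h : y ∉ effDom f) : f y = ⊤ :=
  not_lt_top_iff.1 h

variable {E : Type*} [NormedAddCommGroup E] [InnerProductSpace ℝ E] {f : E → EReal}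

namespace ProperClosedConvex

theorem coe_toReal (hf : ProperClosedConvex f) {y : E} (hy : y ∈ effDom f) :
    ((f y).toReal : EReal) = f y :=
  EReal.coe_toReal (ne_of_lt hy) (hf.ne_bot y)

theorem mem_subdiff_iff (hf : ProperClosedConvex f) {y v : E} :
    v ∈ subdiff f y ↔
      y ∈ effDom f ∧ ∀ u ∈ effDom f, (f y).toReal + inner ℝ v (u - y) ≤ (f u).toReal := by
  constructor
  · intro h
    have hy : y ∈ effDom f := by
      obtain ⟨u, hu⟩ := hf.nonempty_dom
      by_contra hy
      have hy' : f y = ⊤ := eq_top_of_notMem_effDom hy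
      have := h u
      rw [hy', EReal.top_add_coe, top_le_iff] at this
      exact ne_of_lt hu this
    refine ⟨hy, fun u hu => ?_⟩
    have := h u
    rw [← hf.coe_toReal hy, ← hf.coe_toReal hu] at this
    exact_mod_cast this
  · rintro ⟨hy, h⟩ u
    by_cases hu : u ∈ effDom f
    · rw [← hf.coe_toReal hy, ← hf.coe_toReal hu]
      exact_mod_cast h u hu
    · rw [eq_top_of_notMem_effDom hu]
      exact le_top

theorem toReal_add_smul_le (hf : ProperClosedConvex f) {y u : E} (hy : y ∈ effDom f)
    (hu : u ∈ effDom f) {t : ℝ} (h0 : 0 ≤ t) (h1 : t ≤ 1) :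
    (1 - t) • y + t • u ∈ effDom f ∧
      (f ((1 - t) • y + t • u)).toReal ≤ (1 - t) * (f y).toReal + t * (f u).toReal := by
  have hmem := hf.convex (x := (y, (f y).toReal)) (by simp [hf.coe_toReal hy])
    (y := (u, (f u).toReal)) (by simp [hf.coe_toReal hu])
    (sub_nonneg.2 h1) h0 (by ring)
  simp only [Set.mem_ofPred_eq, Prod.fst_add, Prod.smul_fst, Prod.snd_add, Prod.smul_snd,
    smul_eq_mul] at hmem
  have hdom : (1 - t) • y + t • u ∈ effDom f := hmem.trans_lt (EReal.coe_lt_top _)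
  refine ⟨hdom, ?_⟩
  rw [← hf.coe_toReal hdom] at hmem
  exact_mod_cast hmem

theorem mem_effDom_of_isMinOn (hf : ProperClosedConvex f) {q : E → ℝ} {p : E}
    (h : IsMinOn (fun u => f u + (q u : EReal)) Set.univ p) : p ∈ effDom f := by
  obtain ⟨u, hu⟩ := hf.nonempty_dom
  have h1 : f p + (q p : EReal) ≤ f u + (q u : EReal) := h (Set.mem_univ u)
  rw [← hf.coe_toReal hu] at h1
  by_contra hp
  rw [eq_top_of_notMem_effDom hp, EReal.top_add_coe, top_le_iff] at h1
  exact EReal.coe_ne_top _ (by exact_mod_cast h1)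

/-- Fermat's rule for the sum of a convex function and a smooth function with gradient `g` at the
minimizer, the smoothness being stated as a quadratic upper bound. -/
theorem neg_mem_subdiff_of_isMinOn (hf : ProperClosedConvex f) {q : E → ℝ} {p g : E} {K : ℝ}
    (h : IsMinOn (fun u => f u + (q u : EReal)) Set.univ p)
    (hq : ∀ u, q u ≤ q p + inner ℝ g (u - p) + K * ‖u - p‖ ^ 2) : -g ∈ subdiff f p := by
  have hp := hf.mem_effDom_of_isMinOn h
  refine hf.mem_subdiff_iff.2 ⟨hp, fun u hu => ?_⟩
  have key : ∀ t : ℝ, 0 < t → t ≤ 1 →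
      (f p).toReal - (f u).toReal - inner ℝ g (u - p) ≤ K * ‖u - p‖ ^ 2 * t := by
    intro t ht ht1
    obtain ⟨hd, hle⟩ := hf.toReal_add_smul_le hp hu ht.le ht1
    have h1 : f p + (q p : EReal) ≤ f ((1 - t) • p + t • u) + (q ((1 - t) • p + t • u) : EReal) :=
      h (Set.mem_univ _)
    rw [← hf.coe_toReal hd, ← hf.coe_toReal hp] at h1
    have h1' : (f p).toReal + q p ≤
        (f ((1 - t) • p + t • u)).toReal + q ((1 - t) • p + t • u) := by exact_mod_cast h1
    have h2 := hq ((1 - t) • p + t • u)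
    rw [show (1 - t) • p + t • u - p = t • (u - p) by module, inner_smul_right, norm_smul,
      mul_pow, Real.norm_eq_abs, sq_abs] at h2
    have h3 : t * ((f p).toReal - (f u).toReal - inner ℝ g (u - p)) ≤
        t * (K * ‖u - p‖ ^ 2 * t) := by linarith
    exact le_of_mul_le_mul_left h3 ht
  have hlim : Tendsto (fun t : ℝ => K * ‖u - p‖ ^ 2 * t) (𝓝[>] 0) (𝓝 0) := by
    have : Tendsto (fun t : ℝ => K * ‖u - p‖ ^ 2 * t) (𝓝 0) (𝓝 (K * ‖u - p‖ ^ 2 * 0)) :=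
      tendsto_id.const_mul _
    rw [mul_zero] at this
    exact this.mono_left nhdsWithin_le_nhds
  have := ge_of_tendsto hlim (by
    filter_upwards [Ioc_mem_nhdsGT (zero_lt_one' ℝ)] with t ht using key t ht.1 ht.2)
  rw [inner_neg_left]
  linarith

theorem inner_sub_nonneg (hf : ProperClosedConvex f) {y u p q : E} (hp : p ∈ subdiff f y)
    (hq : q ∈ subdiff f u) : 0 ≤ inner ℝ (p - q) (y - u) := by
  obtain ⟨hy, h1⟩ := hf.mem_subdiff_iff.1 hp
  obtain ⟨hu, h2⟩ := hf.mem_subdiff_iff.1 hq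
  have h3 := h1 u hu
  have h4 := h2 y hy
  rw [← neg_sub y u, inner_neg_right] at h3
  rw [inner_sub_left]
  linarith

theorem mem_subdiff_of_tendsto (hf : ProperClosedConvex f) {ys vs : ℕ → E} {y v : E}
    (hy : Tendsto ys atTop (𝓝 y)) (hv : Tendsto vs atTop (𝓝 v))
    (h : ∀ n, vs n ∈ subdiff f (ys n)) : v ∈ subdiff f y := by
  intro u
  by_cases hu : u ∈ effDom f
  swap
  · rw [eq_top_of_notMem_effDom hu]; exact le_top
  have hb : Tendsto (fun n => (f u).toReal - inner ℝ (vs n) (u - ys n)) atTop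
      (𝓝 ((f u).toReal - inner ℝ v (u - y))) :=
    tendsto_const_nhds.sub (hv.inner (tendsto_const_nhds.sub hy))
  have hle : f y ≤ (((f u).toReal - inner ℝ v (u - y) : ℝ) : EReal) := by
    by_contra hlt
    obtain ⟨b, hb1, hb2⟩ := EReal.lt_iff_exists_real_btwn.1 (not_le.1 hlt)
    have hb1' : (f u).toReal - inner ℝ v (u - y) < b := by exact_mod_cast hb1
    have e1 := hy.eventually (hf.closed y b hb2)
    obtain ⟨n, hn1, hn2⟩ := (e1.and (hb.eventually (gt_mem_nhds hb1'))).exists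
    obtain ⟨hd, hs⟩ := hf.mem_subdiff_iff.1 (h n)
    rw [← hf.coe_toReal hd] at hn1
    have hn1' : b < (f (ys n)).toReal := by exact_mod_cast hn1
    linarith [hs u hu]
  have hyd : y ∈ effDom f := hle.trans_lt (EReal.coe_lt_top _)
  rw [← hf.coe_toReal hyd] at hle ⊢
  rw [← hf.coe_toReal hu]
  have : (f y).toReal ≤ (f u).toReal - inner ℝ v (u - y) := by exact_mod_cast hle
  have : (f y).toReal + inner ℝ v (u - y) ≤ (f u).toReal := by linarith
  exact_mod_cast this

/-- The minimum defining `prox f x` is attained. One subgradient of `f` gives an affine minorant,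
which makes the objective coercive. -/
theorem exists_isMinOn_prox [FiniteDimensional ℝ E] (hf : ProperClosedConvex f) {y g : E}
    (hg : g ∈ subdiff f y) (x : E) :
    ∃ p, IsMinOn (fun u => f u + ((1 / 2 * ‖u - x‖ ^ 2 : ℝ) : EReal)) Set.univ p := by
  obtain ⟨hy, hs⟩ := hf.mem_subdiff_iff.1 hg
  set F : E → EReal := fun u => f u + ((1 / 2 * ‖u - x‖ ^ 2 : ℝ) : EReal) with hF
  have hlsc : LowerSemicontinuous F := by
    refine LowerSemicontinuous.add' hf.closed ?_ fun u => ?_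
    · exact (continuous_coe_real_ereal.comp (by fun_prop)).lowerSemicontinuous
    · exact EReal.continuousAt_add (Or.inr (EReal.coe_ne_bot _)) (Or.inr (EReal.coe_ne_top _))
  set R : ℝ := 2 * (‖g‖ + ‖y - x‖) with hR
  have hR0 : 0 ≤ R := by positivity
  obtain ⟨p, -, hp⟩ := (hlsc.lowerSemicontinuousOn (Metric.closedBall y R)).exists_isMinOn
    ⟨y, Metric.mem_closedBall_self hR0⟩ (isCompact_closedBall y R)
  refine ⟨p, fun u _ => ?_⟩
  by_cases hu : u ∈ Metric.closedBall y R
  · exact hp hu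
  refine (isMinOn_iff.1 hp y (Metric.mem_closedBall_self hR0)).trans ?_
  by_cases hud : u ∈ effDom f
  swap
  · simp only [hF]
    rw [eq_top_of_notMem_effDom hud, EReal.top_add_coe]; exact le_top
  -- outside the ball the quadratic term outweighs the affine minorant
  have h1 := hs u hud
  simp only [hF]
  rw [← hf.coe_toReal hy, ← hf.coe_toReal hud]
  have h2 : ‖u - x‖ ^ 2 = ‖u - y‖ ^ 2 + 2 * inner ℝ (y - x) (u - y) + ‖y - x‖ ^ 2 := by
    rw [show u - x = (u - y) + (y - x) by abel, norm_add_sq_real, real_inner_comm]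
  have h3 : R < ‖u - y‖ := by
    rw [mem_closedBall_iff_norm] at hu; exact not_le.1 hu
  have h4 := (abs_le.1 (abs_real_inner_le_norm g (u - y))).1
  have h5 := (abs_le.1 (abs_real_inner_le_norm (y - x) (u - y))).1
  have h6 : (‖g‖ + ‖y - x‖) * ‖u - y‖ ≤ 1 / 2 * ‖u - y‖ ^ 2 := by
    have : R * ‖u - y‖ ≤ ‖u - y‖ * ‖u - y‖ := by gcongr
    rw [hR] at this
    linarith
  have h7 : (f y).toReal + 1 / 2 * ‖y - x‖ ^ 2 ≤ (f u).toReal + 1 / 2 * ‖u - x‖ ^ 2 := by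
    rw [h2]; linarith
  exact_mod_cast h7

/-- An approximate subgradient inclusion bounds the residual of the proximal fixed-point
equation. -/
theorem norm_sub_prox_le [FiniteDimensional ℝ E] (hf : ProperClosedConvex f) {y v b : E}
    (h : v - b ∈ subdiff f y) : ‖y - prox f (y - b)‖ ≤ ‖v‖ := by
  have hex := hf.exists_isMinOn_prox h (y - b)
  have hmin : IsMinOn (fun u => f u + ((1 / 2 * ‖u - (y - b)‖ ^ 2 : ℝ) : EReal)) Set.univ
      (prox f (y - b)) := by
    rw [prox, dif_pos hex]; exact hex.choose_spec
  generalize prox f (y - b) = p at *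
  have hsub := hf.neg_mem_subdiff_of_isMinOn (g := p - (y - b)) (K := 1 / 2) hmin fun u => by
    rw [show u - (y - b) = (p - (y - b)) + (u - p) by abel, norm_add_sq_real]
    linarith
  have hmono := hf.inner_sub_nonneg h hsub
  rw [show v - b - -(p - (y - b)) = v - (y - p) by abel, inner_sub_left,
    real_inner_self_eq_norm_sq] at hmono
  have := real_inner_le_norm v (y - p)
  rcases (norm_nonneg (y - p)).eq_or_lt with h0 | h0
  · rw [← h0]; positivity
  · refine le_of_mul_le_mul_right ?_ h0
    nlinarith

end ProperClosedConvex

end ConvexAnalysis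

/-! ### Positive semidefinite operators -/

section Operators

variable {E : Type*} [NormedAddCommGroup E] [InnerProductSpace ℝ E]

theorem opSeminorm_sq {T : E →ₗ[ℝ] E} (hT : T.IsPositive) (x : E) :
    opSeminorm T x ^ 2 = inner ℝ x (T x) := by
  rw [opSeminorm, Real.sq_sqrt]
  have := hT.2 x
  rwa [RCLike.re_to_real, real_inner_comm] at this

variable [FiniteDimensional ℝ E]

theorem inner_sqrtOp_sqrtOp {T : E →ₗ[ℝ] E} (hT : T.IsPositive) (x y : E) :
    inner ℝ (sqrtOp T x) (sqrtOp T y) = inner ℝ x (T y) := by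
  obtain ⟨h1, h2⟩ := sqrtOp_spec T hT
  rw [h1.1 x, ← LinearMap.comp_apply, h2]

theorem norm_sqrtOp_sq {T : E →ₗ[ℝ] E} (hT : T.IsPositive) (x : E) :
    ‖sqrtOp T x‖ ^ 2 = inner ℝ x (T x) := by
  rw [← real_inner_self_eq_norm_sq, inner_sqrtOp_sqrtOp hT]

theorem norm_apply_le_opNorm {F : Type*} [NormedAddCommGroup F] [InnerProductSpace ℝ F]
    (T : E →ₗ[ℝ] F) (x : E) : ‖T x‖ ≤ opNorm T * ‖x‖ :=
  (LinearMap.toContinuousLinearMap T).le_opNorm x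

theorem opNorm_nonneg {F : Type*} [NormedAddCommGroup F] [InnerProductSpace ℝ F]
    (T : E →ₗ[ℝ] F) : 0 ≤ opNorm T := norm_nonneg _

theorem norm_apply_le_sqrtOp {T : E →ₗ[ℝ] E} (hT : T.IsPositive) (x : E) :
    ‖T x‖ ≤ opNorm (sqrtOp T) * ‖sqrtOp T x‖ := by
  have : T x = sqrtOp T (sqrtOp T x) := by
    rw [← LinearMap.comp_apply, (sqrtOp_spec T hT).2]
  rw [this]
  exact norm_apply_le_opNorm _ _

theorem IsPosDef.exists_pos_mul_norm_sq_le {T : E →ₗ[ℝ] E} (hT : IsPosDef T) :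
    ∃ m > 0, ∀ x, m * ‖x‖ ^ 2 ≤ inner ℝ x (T x) := by
  rcases subsingleton_or_nontrivial E with hE | hE
  · exact ⟨1, one_pos, fun x => by simp [Subsingleton.elim x 0]⟩
  have hc : Continuous fun x : E => inner ℝ x (T x) :=
    continuous_id.inner T.continuous_of_finiteDimensional
  obtain ⟨z, hz, hmin⟩ := (isCompact_sphere (0 : E) 1).exists_isMinOn
    (NormedSpace.sphere_nonempty.2 zero_le_one) hc.continuousOn
  have hz1 : ‖z‖ = 1 := by simpa using hz
  refine ⟨inner ℝ z (T z), hT.2 z (by rintro rfl; simp at hz1), fun x => ?_⟩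
  rcases eq_or_ne x 0 with rfl | hx
  · simp
  have hn : 0 < ‖x‖ := norm_pos_iff.2 hx
  have h1 : inner ℝ z (T z) ≤ inner ℝ (‖x‖⁻¹ • x) (T (‖x‖⁻¹ • x)) :=
    hmin (by simp [norm_smul, hn.ne'])
  rw [map_smul, inner_smul_left, inner_smul_right, RCLike.conj_to_real, ← mul_assoc] at h1
  calc inner ℝ z (T z) * ‖x‖ ^ 2 ≤ (‖x‖⁻¹ * ‖x‖⁻¹ * inner ℝ x (T x)) * ‖x‖ ^ 2 := by gcongr
    _ = _ := by field_simp

end Operators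

/-! ### One step of pADMM as a degenerate proximal point step -/

section ProximalStep

variable {Y Z X : Type*}
  [NormedAddCommGroup Y] [InnerProductSpace ℝ Y] [FiniteDimensional ℝ Y]
  [NormedAddCommGroup Z] [InnerProductSpace ℝ Z] [FiniteDimensional ℝ Z]
  [NormedAddCommGroup X] [InnerProductSpace ℝ X]
  {f₁ : Y → EReal} {f₂ : Z → EReal} {B₁ : Y →ₗ[ℝ] X} {B₂ : Z →ₗ[ℝ] X} {c : X}
  {T₁ : Y →ₗ[ℝ] Y} {T₂ : Z →ₗ[ℝ] Z} {S₁ : Y →ₗ[ℝ] Y} {S₂ : Z →ₗ[ℝ] Z} {σ : ℝ}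

open LinearMap (adjoint)

/-- The Hilbert space in which the seminorm `‖·‖_M` becomes a norm. -/
abbrev FactorSpace (Y Z X : Type*) := WithLp 2 (X × WithLp 2 (Y × Z))

/-- A factor `L` of the degenerate operator `M = L* L`, namely
`L (y, z, x) = (√σ (B₁ y + σ⁻¹ x), √T₁ y, √T₂ z)`. -/
def factorM (B₁ : Y →ₗ[ℝ] X) (T₁ : Y →ₗ[ℝ] Y) (T₂ : Z →ₗ[ℝ] Z) (σ : ℝ) :
    Y × Z × X →ₗ[ℝ] FactorSpace Y Z X where
  toFun w := WithLp.toLp 2 (√σ • (B₁ w.1 + σ⁻¹ • w.2.2),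
    WithLp.toLp 2 (sqrtOp T₁ w.1, sqrtOp T₂ w.2.1))
  map_add' u v := by
    simp only [← WithLp.toLp_add, Prod.mk_add_mk, Prod.fst_add, Prod.snd_add, map_add]
    congr 2
    module
  map_smul' t u := by
    simp only [← WithLp.toLp_smul, Prod.smul_mk, Prod.smul_fst, Prod.smul_snd, map_smul,
      RingHom.id_apply]
    congr 2
    module

theorem inner_factorM (hT₁ : T₁.IsPositive) (hT₂ : T₂.IsPositive) (hσ : 0 < σ)
    (u v : Y × Z × X) :
    inner ℝ (factorM B₁ T₁ T₂ σ u) (factorM B₁ T₁ T₂ σ v) =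
      σ * inner ℝ (B₁ u.1 + σ⁻¹ • u.2.2) (B₁ v.1 + σ⁻¹ • v.2.2)
        + inner ℝ u.1 (T₁ v.1) + inner ℝ u.2.1 (T₂ v.2.1) := by
  simp only [factorM, LinearMap.coe_mk, AddHom.coe_mk, WithLp.prod_inner_apply,
    inner_sqrtOp_sqrtOp hT₁, inner_sqrtOp_sqrtOp hT₂, inner_smul_left, inner_smul_right,
    RCLike.conj_to_real]
  rw [← mul_assoc, Real.mul_self_sqrt hσ.le]
  ring

theorem norm_factorM_sq (hT₁ : T₁.IsPositive) (hT₂ : T₂.IsPositive) (hσ : 0 < σ)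
    (u : Y × Z × X) :
    ‖factorM B₁ T₁ T₂ σ u‖ ^ 2 =
      σ * ‖B₁ u.1 + σ⁻¹ • u.2.2‖ ^ 2 + ‖sqrtOp T₁ u.1‖ ^ 2 + ‖sqrtOp T₂ u.2.1‖ ^ 2 := by
  rw [← real_inner_self_eq_norm_sq, inner_factorM hT₁ hT₂ hσ, real_inner_self_eq_norm_sq,
    norm_sqrtOp_sq hT₁, norm_sqrtOp_sq hT₂]

theorem norm_constraint_le (hT₁ : T₁.IsPositive) (hT₂ : T₂.IsPositive) (hσ : 0 < σ)
    (u : Y × Z × X) :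
    ‖B₁ u.1 + σ⁻¹ • u.2.2‖ ≤ 1 / √σ * ‖factorM B₁ T₁ T₂ σ u‖ := by
  have h := norm_factorM_sq (B₁ := B₁) hT₁ hT₂ hσ u
  have hs := Real.sqrt_pos.2 hσ
  rw [one_div, ← div_eq_inv_mul, le_div_iff₀ hs]
  refine (sq_le_sq₀ (by positivity) (norm_nonneg _)).1 ?_
  rw [mul_pow, Real.sq_sqrt hσ.le, h]
  nlinarith [sq_nonneg ‖sqrtOp T₁ u.1‖, sq_nonneg ‖sqrtOp T₂ u.2.1‖]

theorem norm_sqrtOp_fst_le (hT₁ : T₁.IsPositive) (hT₂ : T₂.IsPositive) (hσ : 0 < σ)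
    (u : Y × Z × X) : ‖sqrtOp T₁ u.1‖ ≤ ‖factorM B₁ T₁ T₂ σ u‖ := by
  refine (sq_le_sq₀ (norm_nonneg _) (norm_nonneg _)).1 ?_
  rw [norm_factorM_sq hT₁ hT₂ hσ]
  have : 0 ≤ σ * ‖B₁ u.1 + σ⁻¹ • u.2.2‖ ^ 2 := by positivity
  nlinarith [sq_nonneg ‖sqrtOp T₂ u.2.1‖]

theorem norm_sqrtOp_snd_le (hT₁ : T₁.IsPositive) (hT₂ : T₂.IsPositive) (hσ : 0 < σ)
    (u : Y × Z × X) : ‖sqrtOp T₂ u.2.1‖ ≤ ‖factorM B₁ T₁ T₂ σ u‖ := by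
  refine (sq_le_sq₀ (norm_nonneg _) (norm_nonneg _)).1 ?_
  rw [norm_factorM_sq hT₁ hT₂ hσ]
  have : 0 ≤ σ * ‖B₁ u.1 + σ⁻¹ • u.2.2‖ ^ 2 := by positivity
  nlinarith [sq_nonneg ‖sqrtOp T₁ u.1‖]

variable [FiniteDimensional ℝ X]

theorem seminormM_eq_norm_factorM (hT₁ : T₁.IsPositive) (hT₂ : T₂.IsPositive) (hσ : 0 < σ)
    (u : Y × Z × X) : seminormM B₁ T₁ T₂ σ u = ‖factorM B₁ T₁ T₂ σ u‖ := by
  rw [seminormM, ← Real.sqrt_sq (norm_nonneg (factorM B₁ T₁ T₂ σ u)),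
    ← real_inner_self_eq_norm_sq, inner_factorM hT₁ hT₂ hσ]
  congr 1
  simp only [prodInner, opM, inner_add_left, inner_add_right, inner_smul_left, inner_smul_right,
    LinearMap.adjoint_inner_right, RCLike.conj_to_real]
  field_simp
  ring

/-- `v` is the result of a proximal point step from `w` with the degenerate preconditioner `M`:
`M (w - v)` lies in the KKT operator
`(y, z, x) ↦ (∂f₁ y + B₁* x, ∂f₂ z + B₂* x, c - B₁ y - B₂ z)` at `v`. -/
structure IsProximalStep (f₁ : Y → EReal) (f₂ : Z → EReal) (B₁ : Y →ₗ[ℝ] X) (B₂ : Z →ₗ[ℝ] X)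
    (c : X) (T₁ : Y →ₗ[ℝ] Y) (T₂ : Z →ₗ[ℝ] Z) (σ : ℝ) (w v : Y × Z × X) : Prop where
  fst_mem : σ • adjoint B₁ (B₁ (w.1 - v.1) + σ⁻¹ • (w.2.2 - v.2.2)) + T₁ (w.1 - v.1)
    - adjoint B₁ v.2.2 ∈ subdiff f₁ v.1
  snd_mem : T₂ (w.2.1 - v.2.1) - adjoint B₂ v.2.2 ∈ subdiff f₂ v.2.1
  constraint : B₁ (w.1 - v.1) + σ⁻¹ • (w.2.2 - v.2.2) = c - B₁ v.1 - B₂ v.2.1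

theorem isProximalStep_self_iff {w : Y × Z × X} :
    IsProximalStep f₁ f₂ B₁ B₂ c T₁ T₂ σ w w ↔ IsKKT f₁ f₂ B₁ B₂ c w := by
  have e : (0 : X) = c - B₁ w.1 - B₂ w.2.1 ↔ B₁ w.1 + B₂ w.2.1 - c = 0 := by
    rw [eq_comm, ← neg_eq_zero]
    refine Eq.congr (by abel) rfl
  constructor
  · rintro ⟨h1, h2, h3⟩
    simp only [sub_self, map_zero, smul_zero, add_zero, zero_sub, e] at h1 h2 h3
    exact ⟨h1, h2, h3⟩
  · rintro ⟨h1, h2, h3⟩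
    constructor <;> simpa [e]

/-- Optimality condition of a subproblem of pADMM. -/
theorem ProperClosedConvex.mem_subdiff_of_isMinOn_augmented {E : Type*} [NormedAddCommGroup E]
    [InnerProductSpace ℝ E] [FiniteDimensional ℝ E] {f : E → EReal} (hf : ProperClosedConvex f)
    {B : E →ₗ[ℝ] X} {T : E →ₗ[ℝ] E} (hT : T.IsPositive) (hσ : 0 < σ) {b x : X} {p v : E}
    (h : IsMinOn (fun u => f u + ((inner ℝ x (B u + b) + σ / 2 * ‖B u + b‖ ^ 2
      + 1 / 2 * opSeminorm T (u - v) ^ 2 : ℝ) : EReal)) Set.univ p) :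
    T (v - p) - adjoint B (x + σ • (B p + b)) ∈ subdiff f p := by
  have := hf.neg_mem_subdiff_of_isMinOn
    (g := adjoint B (x + σ • (B p + b)) + T (p - v))
    (K := σ / 2 * opNorm B ^ 2 + 1 / 2 * opNorm T) h fun u => ?_
  · convert this using 1
    rw [← neg_sub p v, map_neg]
    abel
  · rw [opSeminorm_sq hT, opSeminorm_sq hT]
    have e1 : B u + b = (B p + b) + B (u - p) := by rw [map_sub]; abel
    have e2 : u - v = (p - v) + (u - p) := by abel
    rw [e1, e2]
    generalize u - p = d
    have h1 : ‖B d‖ ^ 2 ≤ opNorm B ^ 2 * ‖d‖ ^ 2 := by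
      rw [← mul_pow]; gcongr; exact norm_apply_le_opNorm B d
    have h2 : inner ℝ d (T d) ≤ opNorm T * ‖d‖ ^ 2 := by
      refine (real_inner_le_norm _ _).trans ?_
      rw [sq, ← mul_assoc, mul_comm]
      gcongr
      exact norm_apply_le_opNorm T d
    have h3 : inner ℝ (T (p - v)) d = inner ℝ (p - v) (T d) := hT.1 _ _
    have h4 : inner ℝ d (T (p - v)) = inner ℝ (p - v) (T d) := by rw [real_inner_comm, h3]
    rw [norm_add_sq_real (B p + b)]
    simp only [map_add, inner_add_left, inner_add_right _ (B p + b) (B d),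
      inner_add_right _ _ (T d), inner_smul_left, LinearMap.adjoint_inner_left,
      RCLike.conj_to_real, h3, h4]
    have h5 : σ / 2 * ‖B d‖ ^ 2 ≤ σ / 2 * (opNorm B ^ 2 * ‖d‖ ^ 2) := by gcongr
    linarith

theorem IsGenerated.isProximalStep {α ρ : ℝ} {w wbar what : ℕ → Y × Z × X}
    (hf₁ : ProperClosedConvex f₁) (hf₂ : ProperClosedConvex f₂)
    (hT₁ : T₁.IsPositive) (hT₂ : T₂.IsPositive) (hσ : 0 < σ)
    (h : IsGenerated f₁ f₂ B₁ B₂ c T₁ T₂ σ α ρ w wbar what) (k : ℕ) :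
    IsProximalStep f₁ f₂ B₁ B₂ c T₁ T₂ σ (w k) (wbar k) := by
  have hx := h.step2 k
  have hz := hf₂.mem_subdiff_of_isMinOn_augmented (B := B₂) (b := B₁ (w k).1 - c) hT₂ hσ
    (x := (w k).2.2) (v := (w k).2.1) (p := (wbar k).2.1) (by
      have := h.step1 k
      have e : ∀ z, B₁ (w k).1 + B₂ z - c = B₂ z + (B₁ (w k).1 - c) := fun z => by abel
      simp only [augTerm, e] at this
      exact this)
  have hy := hf₁.mem_subdiff_of_isMinOn_augmented (B := B₁) (b := B₂ (wbar k).2.1 - c) hT₁ hσ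
    (x := (wbar k).2.2) (v := (w k).1) (p := (wbar k).1) (by
      have := h.step3 k
      have e : ∀ y, B₁ y + B₂ (wbar k).2.1 - c = B₁ y + (B₂ (wbar k).2.1 - c) := fun y => by abel
      simp only [augTerm, e] at this
      exact this)
  have hs : B₁ ((w k).1 - (wbar k).1) + σ⁻¹ • ((w k).2.2 - (wbar k).2.2) =
      c - B₁ (wbar k).1 - B₂ (wbar k).2.1 := by
    rw [hx, sub_add_cancel_left, smul_neg, smul_smul, inv_mul_cancel₀ hσ.ne', one_smul, map_sub]
    abel
  refine ⟨?_, ?_, hs⟩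
  · rw [hs]
    convert hy using 1
    simp only [map_add, map_smul, map_sub]
    module
  · convert hz using 2
    rw [hx]
    congr 3
    abel

/-- Positive definiteness of `S + B* B + T` makes a subproblem of pADMM strongly monotone. -/
theorem IsConvexityOperator.exists_norm_sub_le {E : Type*} [NormedAddCommGroup E]
    [InnerProductSpace ℝ E] [FiniteDimensional ℝ E] {f : E → EReal} (hf : ProperClosedConvex f)
    {S T : E →ₗ[ℝ] E} {B : E →ₗ[ℝ] X} (hS : IsConvexityOperator f S) (hT : T.IsPositive)
    (hpd : IsPosDef (S + adjoint B ∘ₗ B + T)) (hσ : 0 < σ) :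
    ∃ K, 0 ≤ K ∧ ∀ y y' p p' g, p ∈ subdiff f y → p' ∈ subdiff f y' →
      p - p' = g - σ • adjoint B (B (y - y')) - T (y - y') → ‖y - y'‖ ≤ K * ‖g‖ := by
  obtain ⟨m, hm, hmle⟩ := hpd.exists_pos_mul_norm_sq_le
  have hmin : 0 < min 1 σ := lt_min one_pos hσ
  refine ⟨(min 1 σ * m)⁻¹, by positivity, fun y y' p p' g hp hp' hg => ?_⟩
  have h1 := hS.strong_monotone y (hf.mem_subdiff_iff.1 hp).1 y' (hf.mem_subdiff_iff.1 hp').1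
    p hp p' hp'
  rw [hg, opSeminorm_sq hS.isPositive] at h1
  generalize y - y' = d at *
  have h2 := hmle d
  have h3 : 0 ≤ inner ℝ d (S d) := by
    rw [← opSeminorm_sq hS.isPositive]; positivity
  have h4 : 0 ≤ inner ℝ d (T d) := by
    rw [← opSeminorm_sq hT]; positivity
  have h5 : inner ℝ (T d) d = inner ℝ d (T d) := real_inner_comm _ _
  simp only [LinearMap.add_apply, LinearMap.comp_apply, inner_add_right,
    LinearMap.adjoint_inner_right, real_inner_self_eq_norm_sq] at h2
  simp only [inner_sub_left, inner_smul_left, LinearMap.adjoint_inner_left, RCLike.conj_to_real,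
    real_inner_self_eq_norm_sq, h5] at h1
  have h6 := real_inner_le_norm g d
  have h7 : 0 ≤ ‖B d‖ ^ 2 := by positivity
  have h8 : min 1 σ * (m * ‖d‖ ^ 2) ≤ inner ℝ d (S d) + σ * ‖B d‖ ^ 2 + inner ℝ d (T d) := by
    calc min 1 σ * (m * ‖d‖ ^ 2)
        ≤ min 1 σ * (inner ℝ d (S d) + ‖B d‖ ^ 2 + inner ℝ d (T d)) := by gcongr
      _ = min 1 σ * inner ℝ d (S d) + min 1 σ * ‖B d‖ ^ 2 + min 1 σ * inner ℝ d (T d) := by ring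
      _ ≤ 1 * inner ℝ d (S d) + σ * ‖B d‖ ^ 2 + 1 * inner ℝ d (T d) := by
          gcongr
          · exact min_le_left _ _
          · exact min_le_right _ _
          · exact min_le_left _ _
      _ = _ := by ring
  rw [← div_eq_inv_mul, le_div_iff₀ (by positivity)]
  rcases (norm_nonneg d).eq_or_lt with h0 | h0
  · rw [← h0]; simp
  · refine le_of_mul_le_mul_right ?_ h0
    linarith

namespace IsProximalStep

/-- The KKT operator is monotone. -/
theorem inner_sub_nonneg (hf₁ : ProperClosedConvex f₁) (hf₂ : ProperClosedConvex f₂)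
    (hT₁ : T₁.IsPositive) (hT₂ : T₂.IsPositive) (hσ : 0 < σ) {w v w' v' : Y × Z × X}
    (h : IsProximalStep f₁ f₂ B₁ B₂ c T₁ T₂ σ w v)
    (h' : IsProximalStep f₁ f₂ B₁ B₂ c T₁ T₂ σ w' v') :
    0 ≤ inner ℝ (factorM B₁ T₁ T₂ σ ((w - v) - (w' - v'))) (factorM B₁ T₁ T₂ σ (v - v')) := by
  have m1 := hf₁.inner_sub_nonneg h.fst_mem h'.fst_mem
  have m2 := hf₂.inner_sub_nonneg h.snd_mem h'.snd_mem
  have hc : (B₁ (w.1 - v.1) + σ⁻¹ • (w.2.2 - v.2.2)) - (B₁ (w'.1 - v'.1) + σ⁻¹ • (w'.2.2 - v'.2.2))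
      = -(B₁ (v.1 - v'.1) + B₂ (v.2.1 - v'.2.1)) := by
    rw [h.constraint, h'.constraint, map_sub, map_sub]; abel
  rw [inner_factorM hT₁ hT₂ hσ]
  simp only [Prod.fst_sub, Prod.snd_sub]
  rw [show B₁ (w.1 - v.1 - (w'.1 - v'.1)) + σ⁻¹ • (w.2.2 - v.2.2 - (w'.2.2 - v'.2.2)) =
    (B₁ (w.1 - v.1) + σ⁻¹ • (w.2.2 - v.2.2)) - (B₁ (w'.1 - v'.1) + σ⁻¹ • (w'.2.2 - v'.2.2)) by
      rw [map_sub]; module]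
  rw [show ∀ s s' : X, ∀ t t' : Y, σ • adjoint B₁ s + T₁ t - adjoint B₁ v.2.2
      - (σ • adjoint B₁ s' + T₁ t' - adjoint B₁ v'.2.2)
      = σ • adjoint B₁ (s - s') + T₁ (t - t') - adjoint B₁ (v.2.2 - v'.2.2) from
      fun s s' t t' => by simp only [map_sub]; module] at m1
  rw [show T₂ (w.2.1 - v.2.1) - adjoint B₂ v.2.2 - (T₂ (w'.2.1 - v'.2.1) - adjoint B₂ v'.2.2)
      = T₂ ((w.2.1 - v.2.1) - (w'.2.1 - v'.2.1)) - adjoint B₂ (v.2.2 - v'.2.2) by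
      simp only [map_sub]; abel] at m2
  generalize (B₁ (w.1 - v.1) + σ⁻¹ • (w.2.2 - v.2.2)) -
    (B₁ (w'.1 - v'.1) + σ⁻¹ • (w'.2.2 - v'.2.2)) = s at *
  generalize w.1 - v.1 - (w'.1 - v'.1) = ty at *
  generalize w.2.1 - v.2.1 - (w'.2.1 - v'.2.1) = tz at *
  generalize v.1 - v'.1 = dy at *
  generalize v.2.1 - v'.2.1 = dz at *
  generalize v.2.2 - v'.2.2 = dx at *
  have hs := congrArg (fun q => inner ℝ q dx) hc
  simp only [inner_neg_left, inner_add_left] at hs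
  rw [real_inner_comm dx (B₁ dy), real_inner_comm dx (B₂ dz)] at hs
  simp only [inner_sub_left, inner_add_left, inner_smul_left, LinearMap.adjoint_inner_left,
    RCLike.conj_to_real] at m1 m2
  have h1 : inner ℝ (T₁ ty) dy = inner ℝ ty (T₁ dy) := hT₁.1 _ _
  have h2 : inner ℝ (T₂ tz) dz = inner ℝ tz (T₂ dz) := hT₂.1 _ _
  rw [inner_add_right, inner_smul_right, mul_add, ← mul_assoc, mul_inv_cancel₀ hσ.ne', one_mul]
  linarith

theorem norm_sub_le (hf₁ : ProperClosedConvex f₁) (hf₂ : ProperClosedConvex f₂)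
    (hT₁ : T₁.IsPositive) (hT₂ : T₂.IsPositive) (hσ : 0 < σ) {w v w' v' : Y × Z × X}
    (h : IsProximalStep f₁ f₂ B₁ B₂ c T₁ T₂ σ w v)
    (h' : IsProximalStep f₁ f₂ B₁ B₂ c T₁ T₂ σ w' v') :
    ‖factorM B₁ T₁ T₂ σ (v - v')‖ ≤ ‖factorM B₁ T₁ T₂ σ (w - w')‖ := by
  have h1 := h.inner_sub_nonneg hf₁ hf₂ hT₁ hT₂ hσ h'
  rw [show w - v - (w' - v') = (w - w') - (v - v') by abel, map_sub, inner_sub_left,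
    real_inner_self_eq_norm_sq] at h1
  have h2 := real_inner_le_norm (factorM B₁ T₁ T₂ σ (w - w')) (factorM B₁ T₁ T₂ σ (v - v'))
  rcases (norm_nonneg (factorM B₁ T₁ T₂ σ (v - v'))).eq_or_lt with h0 | h0
  · rw [← h0]; positivity
  · refine le_of_mul_le_mul_right ?_ h0
    linarith

/-- The proximal point step is a Lipschitz function of `L w`, in the full norm and not only in the
seminorm `‖·‖_M`. -/
theorem exists_lipschitz (hf₁ : ProperClosedConvex f₁) (hf₂ : ProperClosedConvex f₂)
    (hT₁ : T₁.IsPositive) (hT₂ : T₂.IsPositive) (hS₁ : IsConvexityOperator f₁ S₁)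
    (hS₂ : IsConvexityOperator f₂ S₂) (hpd₁ : IsPosDef (S₁ + adjoint B₁ ∘ₗ B₁ + T₁))
    (hpd₂ : IsPosDef (S₂ + adjoint B₂ ∘ₗ B₂ + T₂)) (hσ : 0 < σ) :
    ∃ K, 0 ≤ K ∧ ∀ w v w' v', IsProximalStep f₁ f₂ B₁ B₂ c T₁ T₂ σ w v →
      IsProximalStep f₁ f₂ B₁ B₂ c T₁ T₂ σ w' v' →
      ‖v - v'‖ ≤ K * ‖factorM B₁ T₁ T₂ σ w - factorM B₁ T₁ T₂ σ w'‖ := by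
  obtain ⟨K₁, hK₁, hy⟩ := hS₁.exists_norm_sub_le hf₁ hT₁ hpd₁ hσ
  obtain ⟨K₂, hK₂, hz⟩ := hS₂.exists_norm_sub_le hf₂ hT₂ hpd₂ hσ
  set b₁ := opNorm (adjoint B₁)
  set b₂ := opNorm (adjoint B₂)
  have hb₁ : 0 ≤ b₁ := opNorm_nonneg _
  have hb₂ : 0 ≤ b₂ := opNorm_nonneg _
  have hB₂ := opNorm_nonneg B₂
  have ht₁ := opNorm_nonneg (sqrtOp T₁)
  have ht₂ := opNorm_nonneg (sqrtOp T₂)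
  -- the subproblems determine `z`, then the multiplier `x`, then `y`
  set Cz := K₂ * (opNorm (sqrtOp T₂) + σ * (b₂ * (1 / √σ))) with hCz
  set Cx := σ * (1 / √σ + opNorm B₂ * Cz) with hCx
  set Cy := K₁ * (σ * (b₁ * (1 / √σ)) + 2 * (b₁ * Cx) + opNorm (sqrtOp T₁)) with hCy
  have hCz0 : 0 ≤ Cz := by positivity
  have hCx0 : 0 ≤ Cx := by positivity
  have hCy0 : 0 ≤ Cy := by positivity
  refine ⟨Cy + Cz + Cx, by positivity, fun w v w' v' h h' => ?_⟩
  rw [← map_sub]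
  have hs := norm_constraint_le (B₁ := B₁) hT₁ hT₂ hσ (w - w')
  have hty := (norm_apply_le_sqrtOp hT₁ (w - w').1).trans
    (mul_le_mul_of_nonneg_left (norm_sqrtOp_fst_le (B₁ := B₁) hT₁ hT₂ hσ (w - w')) ht₁)
  have htz := (norm_apply_le_sqrtOp hT₂ (w - w').2.1).trans
    (mul_le_mul_of_nonneg_left (norm_sqrtOp_snd_le (B₁ := B₁) hT₁ hT₂ hσ (w - w')) ht₂)
  generalize hN : ‖factorM B₁ T₁ T₂ σ (w - w')‖ = N at *
  have hN0 : 0 ≤ N := hN ▸ norm_nonneg _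
  simp only [Prod.fst_sub, Prod.snd_sub] at hs hty htz
  -- the constraint determines the multiplier of the new point
  have hx : ∀ {w v : Y × Z × X}, IsProximalStep f₁ f₂ B₁ B₂ c T₁ T₂ σ w v →
      v.2.2 = σ • (B₁ w.1 + σ⁻¹ • w.2.2 + B₂ v.2.1 - c) := fun {w v} h => by
    have h1 := congrArg (fun q => σ • q) h.constraint
    simp only [smul_add, smul_sub, smul_smul, mul_inv_cancel₀ hσ.ne', one_smul, map_sub] at h1 ⊢
    rw [← sub_eq_zero] at h1 ⊢
    rw [← neg_eq_zero, ← h1]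
    abel
  have hdx : v.2.2 - v'.2.2 =
      σ • (B₁ (w.1 - w'.1) + σ⁻¹ • (w.2.2 - w'.2.2) + B₂ (v.2.1 - v'.2.1)) := by
    rw [hx h, hx h', map_sub, map_sub]; module
  have bz : ‖v.2.1 - v'.2.1‖ ≤ Cz * N := by
    refine (hz _ _ _ _ (T₂ (w.2.1 - w'.2.1)
      - σ • adjoint B₂ (B₁ (w.1 - w'.1) + σ⁻¹ • (w.2.2 - w'.2.2))) h.snd_mem h'.snd_mem ?_).trans ?_
    · have := congrArg (adjoint B₂) hdx
      rw [map_sub, map_smul, map_add, smul_add] at this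
      rw [show T₂ (w.2.1 - v.2.1) - adjoint B₂ v.2.2 - (T₂ (w'.2.1 - v'.2.1) - adjoint B₂ v'.2.2)
        = T₂ (w.2.1 - v.2.1) - T₂ (w'.2.1 - v'.2.1) - (adjoint B₂ v.2.2 - adjoint B₂ v'.2.2) by abel,
        this]
      simp only [map_sub]
      abel
    · rw [hCz, mul_assoc]
      gcongr
      refine (_root_.norm_sub_le _ _).trans ?_
      rw [norm_smul, Real.norm_of_nonneg hσ.le, add_mul, mul_assoc, mul_assoc]
      gcongr
      exact (norm_apply_le_opNorm _ _).trans (mul_le_mul_of_nonneg_left hs hb₂)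
  have bx : ‖v.2.2 - v'.2.2‖ ≤ Cx * N := by
    rw [hdx, norm_smul, Real.norm_of_nonneg hσ.le, hCx, mul_assoc]
    gcongr
    refine (norm_add_le _ _).trans ?_
    rw [add_mul, mul_assoc]
    gcongr
    exact (norm_apply_le_opNorm _ _).trans (mul_le_mul_of_nonneg_left bz hB₂)
  have bby : ‖v.1 - v'.1‖ ≤ Cy * N := by
    refine (hy _ _ _ _ (σ • adjoint B₁ (B₁ (w.1 - w'.1) + σ⁻¹ • (w.2.2 - w'.2.2))
      - (2 : ℝ) • adjoint B₁ (v.2.2 - v'.2.2) + T₁ (w.1 - w'.1)) h.fst_mem h'.fst_mem ?_).trans ?_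
    · simp only [map_sub, map_add, map_smul, smul_sub, smul_add, smul_smul,
        mul_inv_cancel₀ hσ.ne', one_smul]
      module
    · rw [hCy, mul_assoc]
      gcongr
      refine (norm_add_le _ _).trans ?_
      rw [add_mul]
      refine add_le_add ((_root_.norm_sub_le _ _).trans ?_) hty
      rw [norm_smul, norm_smul, Real.norm_of_nonneg hσ.le, Real.norm_of_nonneg zero_le_two, add_mul,
        mul_assoc, mul_assoc, mul_assoc, mul_assoc]
      gcongr
      · exact (norm_apply_le_opNorm _ _).trans (mul_le_mul_of_nonneg_left hs hb₁)
      · exact (norm_apply_le_opNorm _ _).trans (mul_le_mul_of_nonneg_left bx hb₁)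
  have p1 : 0 ≤ Cy * N := by positivity
  have p2 : 0 ≤ Cz * N := by positivity
  have p3 : 0 ≤ Cx * N := by positivity
  rw [add_mul, add_mul]
  refine norm_prod_le_iff.2 ⟨?_, norm_prod_le_iff.2 ⟨?_, ?_⟩⟩
  · simp only [Prod.fst_sub]; linarith
  · simp only [Prod.fst_sub, Prod.snd_sub]; linarith
  · simp only [Prod.snd_sub]; linarith

end IsProximalStep

end ProximalStep

/-! ### The set of KKT points -/

section KKT

variable {Y Z X : Type*}
  [NormedAddCommGroup Y] [InnerProductSpace ℝ Y] [FiniteDimensional ℝ Y]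
  [NormedAddCommGroup Z] [InnerProductSpace ℝ Z] [FiniteDimensional ℝ Z]
  [NormedAddCommGroup X] [InnerProductSpace ℝ X] [FiniteDimensional ℝ X]
  {f₁ : Y → EReal} {f₂ : Z → EReal} {B₁ : Y →ₗ[ℝ] X} {B₂ : Z →ₗ[ℝ] X} {c : X}
  {T₁ : Y →ₗ[ℝ] Y} {T₂ : Z →ₗ[ℝ] Z} {S₁ : Y →ₗ[ℝ] Y} {S₂ : Z →ₗ[ℝ] Z} {σ : ℝ}

open LinearMap (adjoint)

theorem IsKKT.mem_effDom (hf₁ : ProperClosedConvex f₁) (hf₂ : ProperClosedConvex f₂)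
    {w : Y × Z × X} (h : IsKKT f₁ f₂ B₁ B₂ c w) : w.1 ∈ effDom f₁ ∧ w.2.1 ∈ effDom f₂ :=
  ⟨(hf₁.mem_subdiff_iff.1 h.1).1, (hf₂.mem_subdiff_iff.1 h.2.1).1⟩

/-- Primal parts and multipliers of KKT points can be combined freely. Both points are optimal, so
the two subgradient inequalities between them are equalities. -/
theorem IsKKT.exchange (hf₁ : ProperClosedConvex f₁) (hf₂ : ProperClosedConvex f₂)
    {w w' : Y × Z × X} (h : IsKKT f₁ f₂ B₁ B₂ c w) (h' : IsKKT f₁ f₂ B₁ B₂ c w') :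
    IsKKT f₁ f₂ B₁ B₂ c (w.1, w.2.1, w'.2.2) := by
  obtain ⟨hy, sy⟩ := hf₁.mem_subdiff_iff.1 h.1
  obtain ⟨hz, sz⟩ := hf₂.mem_subdiff_iff.1 h.2.1
  obtain ⟨hy', sy'⟩ := hf₁.mem_subdiff_iff.1 h'.1
  obtain ⟨hz', sz'⟩ := hf₂.mem_subdiff_iff.1 h'.2.1
  have e : ∀ x : X, inner ℝ x (B₁ (w'.1 - w.1)) + inner ℝ x (B₂ (w'.2.1 - w.2.1)) = 0 := by
    intro x
    rw [← inner_add_right, map_sub, map_sub,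
      show B₁ w'.1 - B₁ w.1 + (B₂ w'.2.1 - B₂ w.2.1) =
        (B₁ w'.1 + B₂ w'.2.1 - c) - (B₁ w.1 + B₂ w.2.1 - c) by abel, h.2.2, h'.2.2, sub_zero,
      inner_zero_right]
  have e1 := e w.2.2
  have e2 := e w'.2.2
  have a1 := sy _ hy'
  have a2 := sz _ hz'
  have a3 := sy' _ hy
  have a4 := sz' _ hz
  rw [inner_neg_left, LinearMap.adjoint_inner_left] at a1 a2 a3 a4
  rw [← neg_sub, map_neg, inner_neg_right] at a3 a4
  refine ⟨hf₁.mem_subdiff_iff.2 ⟨hy, fun u hu => ?_⟩, hf₂.mem_subdiff_iff.2 ⟨hz, fun u hu => ?_⟩,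
    h.2.2⟩
  · have := sy' u hu
    rw [inner_neg_left, LinearMap.adjoint_inner_left] at this ⊢
    rw [show u - w'.1 = (u - w.1) - (w'.1 - w.1) by abel, map_sub, inner_sub_right] at this
    dsimp only
    linarith
  · have := sz' u hu
    rw [inner_neg_left, LinearMap.adjoint_inner_left] at this ⊢
    rw [show u - w'.2.1 = (u - w.2.1) - (w'.2.1 - w.2.1) by abel, map_sub, inner_sub_right] at this
    dsimp only
    linarith

/-- If `v` and `v'` are subgradients at both `y` and `y'`, the same combinations of the two pairs
are again a subgradient and its base point: the subgradient inequality is averaged over all four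
pairs. -/
theorem ProperClosedConvex.smul_add_smul_mem_subdiff {E : Type*} [NormedAddCommGroup E]
    [InnerProductSpace ℝ E] {f : E → EReal} (hf : ProperClosedConvex f) {y y' v v' : E}
    (h₁ : v ∈ subdiff f y) (h₂ : v' ∈ subdiff f y) (h₃ : v ∈ subdiff f y') (h₄ : v' ∈ subdiff f y')
    {s t : ℝ} (hs : 0 ≤ s) (ht : 0 ≤ t) (hst : s + t = 1) :
    s • v + t • v' ∈ subdiff f (s • y + t • y') := by
  obtain ⟨hy, a1⟩ := hf.mem_subdiff_iff.1 h₁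
  obtain ⟨hy', a3⟩ := hf.mem_subdiff_iff.1 h₃
  obtain ⟨-, a2⟩ := hf.mem_subdiff_iff.1 h₂
  obtain ⟨-, a4⟩ := hf.mem_subdiff_iff.1 h₄
  obtain rfl : s = 1 - t := by linarith
  obtain ⟨hd, hle⟩ := hf.toReal_add_smul_le hy hy' ht (by linarith)
  refine hf.mem_subdiff_iff.2 ⟨hd, fun u hu => ?_⟩
  have b1 := a1 u hu
  have b2 := a2 u hu
  have b3 := a3 u hu
  have b4 := a4 u hu
  have c1 := mul_le_mul_of_nonneg_left b1 (mul_nonneg hs hs)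
  have c2 := mul_le_mul_of_nonneg_left b2 (mul_nonneg hs ht)
  have c3 := mul_le_mul_of_nonneg_left b3 (mul_nonneg hs ht)
  have c4 := mul_le_mul_of_nonneg_left b4 (mul_nonneg ht ht)
  rw [show u - ((1 - t) • y + t • y') = (1 - t) • (u - y) + t • (u - y') by module]
  simp only [inner_add_left, inner_add_right, inner_smul_left, inner_smul_right,
    RCLike.conj_to_real]
  linarith

theorem convex_setOf_isKKT (hf₁ : ProperClosedConvex f₁) (hf₂ : ProperClosedConvex f₂) :
    Convex ℝ {w : Y × Z × X | IsKKT f₁ f₂ B₁ B₂ c w} := by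
  intro w hw w' hw' s t hs ht hst
  have h : IsKKT f₁ f₂ B₁ B₂ c w := hw
  have h' : IsKKT f₁ f₂ B₁ B₂ c w' := hw'
  have k := h.exchange hf₁ hf₂ h'
  have k' := h'.exchange hf₁ hf₂ h
  have e1 := hf₁.smul_add_smul_mem_subdiff h.1 k.1 k'.1 h'.1 hs ht hst
  have e2 := hf₂.smul_add_smul_mem_subdiff h.2.1 k.2.1 k'.2.1 h'.2.1 hs ht hst
  refine ⟨?_, ?_, ?_⟩
  · change -adjoint B₁ (s • w.2.2 + t • w'.2.2) ∈ subdiff f₁ (s • w.1 + t • w'.1)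
    rw [map_add, map_smul, map_smul, neg_add, ← smul_neg, ← smul_neg]
    exact e1
  · change -adjoint B₂ (s • w.2.2 + t • w'.2.2) ∈ subdiff f₂ (s • w.2.1 + t • w'.2.1)
    rw [map_add, map_smul, map_smul, neg_add, ← smul_neg, ← smul_neg]
    exact e2
  · have e3 : s • (B₁ w.1 + B₂ w.2.1 - c) + t • (B₁ w'.1 + B₂ w'.2.1 - c) = 0 := by
      rw [h.2.2, h'.2.2, smul_zero, smul_zero, add_zero]
    rw [← e3]
    simp only [Prod.fst_add, Prod.snd_add, Prod.smul_fst, Prod.smul_snd, map_add, map_smul]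
    obtain rfl : s = 1 - t := by linarith
    module

/-- Closedness of the fixed-point relation: along proximal steps whose starting points converge in
the seminorm `‖·‖_M` and whose lengths vanish in it, the new points converge in norm to a KKT
point. -/
theorem exists_tendsto_isKKT (hf₁ : ProperClosedConvex f₁) (hf₂ : ProperClosedConvex f₂)
    (hT₁ : T₁.IsPositive) (hT₂ : T₂.IsPositive) (hS₁ : IsConvexityOperator f₁ S₁)
    (hS₂ : IsConvexityOperator f₂ S₂) (hpd₁ : IsPosDef (S₁ + adjoint B₁ ∘ₗ B₁ + T₁))
    (hpd₂ : IsPosDef (S₂ + adjoint B₂ ∘ₗ B₂ + T₂)) (hσ : 0 < σ) {ws vs : ℕ → Y × Z × X}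
    (h : ∀ n, IsProximalStep f₁ f₂ B₁ B₂ c T₁ T₂ σ (ws n) (vs n)) {q : FactorSpace Y Z X}
    (hq : Tendsto (fun n => factorM B₁ T₁ T₂ σ (ws n)) atTop (𝓝 q))
    (h0 : Tendsto (fun n => factorM B₁ T₁ T₂ σ (ws n - vs n)) atTop (𝓝 0)) :
    ∃ v, IsKKT f₁ f₂ B₁ B₂ c v ∧ factorM B₁ T₁ T₂ σ v = q ∧ Tendsto vs atTop (𝓝 v) := by
  obtain ⟨K, hK, hlip⟩ := IsProximalStep.exists_lipschitz (c := c) hf₁ hf₂ hT₁ hT₂ hS₁ hS₂ hpd₁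
    hpd₂ hσ
  have hcauchy : CauchySeq vs := by
    rw [Metric.cauchySeq_iff]
    intro ε hε
    obtain ⟨N, hN⟩ := Metric.cauchySeq_iff.1 hq.cauchySeq (ε / (K + 1)) (by positivity)
    refine ⟨N, fun m hm n hn => ?_⟩
    have h1 := hN m hm n hn
    rw [dist_eq_norm] at h1 ⊢
    calc ‖vs m - vs n‖ ≤ K * ‖factorM B₁ T₁ T₂ σ (ws m) - factorM B₁ T₁ T₂ σ (ws n)‖ :=
          hlip _ _ _ _ (h m) (h n)
      _ ≤ K * (ε / (K + 1)) := by gcongr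
      _ < ε := by
          rw [← mul_div_assoc, div_lt_iff₀ (by positivity)]
          linarith
  have : CompleteSpace (Y × Z × X) := FiniteDimensional.complete ℝ _
  obtain ⟨v, hv⟩ := cauchySeq_tendsto_of_complete hcauchy
  have hL : Continuous (factorM B₁ T₁ T₂ σ) := LinearMap.continuous_of_finiteDimensional _
  have hB₁ : Continuous B₁ := LinearMap.continuous_of_finiteDimensional _
  have hB₂ : Continuous B₂ := LinearMap.continuous_of_finiteDimensional _
  have hA₁ : Continuous (adjoint B₁) := LinearMap.continuous_of_finiteDimensional _
  have hA₂ : Continuous (adjoint B₂) := LinearMap.continuous_of_finiteDimensional _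
  have hv1 : Tendsto (fun n => (vs n).1) atTop (𝓝 v.1) := (continuous_fst.tendsto v).comp hv
  have hv2 : Tendsto (fun n => (vs n).2.1) atTop (𝓝 v.2.1) :=
    ((continuous_fst.comp continuous_snd).tendsto v).comp hv
  have hv3 : Tendsto (fun n => (vs n).2.2) atTop (𝓝 v.2.2) :=
    ((continuous_snd.comp continuous_snd).tendsto v).comp hv
  have h0n := h0.norm
  rw [norm_zero] at h0n
  have hs : Tendsto (fun n => B₁ (ws n - vs n).1 + σ⁻¹ • (ws n - vs n).2.2) atTop (𝓝 0) :=
    squeeze_zero_norm (fun n => norm_constraint_le hT₁ hT₂ hσ _) (by simpa using h0n.const_mul _)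
  have ht1 : Tendsto (fun n => T₁ (ws n - vs n).1) atTop (𝓝 0) :=
    squeeze_zero_norm (fun n => (norm_apply_le_sqrtOp hT₁ _).trans
      (mul_le_mul_of_nonneg_left (norm_sqrtOp_fst_le (B₁ := B₁) hT₁ hT₂ hσ _) (opNorm_nonneg _)))
      (by simpa using h0n.const_mul _)
  have ht2 : Tendsto (fun n => T₂ (ws n - vs n).2.1) atTop (𝓝 0) :=
    squeeze_zero_norm (fun n => (norm_apply_le_sqrtOp hT₂ _).trans
      (mul_le_mul_of_nonneg_left (norm_sqrtOp_snd_le (B₁ := B₁) hT₁ hT₂ hσ _) (opNorm_nonneg _)))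
      (by simpa using h0n.const_mul _)
  refine ⟨v, ⟨?_, ?_, ?_⟩, ?_, hv⟩
  · refine hf₁.mem_subdiff_of_tendsto hv1 ?_ fun n => (h n).fst_mem
    have := ((((hA₁.tendsto 0).comp hs).const_smul σ).add ht1).sub ((hA₁.tendsto _).comp hv3)
    simpa using this
  · refine hf₂.mem_subdiff_of_tendsto hv2 ?_ fun n => (h n).snd_mem
    simpa using ht2.sub ((hA₂.tendsto _).comp hv3)
  · have h1 : Tendsto (fun n => B₁ (vs n).1 + B₂ (vs n).2.1 - c) atTop
        (𝓝 (B₁ v.1 + B₂ v.2.1 - c)) :=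
      (((hB₁.tendsto _).comp hv1).add ((hB₂.tendsto _).comp hv2)).sub_const c
    refine tendsto_nhds_unique h1 ?_
    have := hs.neg
    rw [neg_zero] at this
    refine this.congr fun n => ?_
    simp only [Prod.fst_sub, Prod.snd_sub, (h n).constraint]
    abel
  · refine tendsto_nhds_unique ((hL.tendsto v).comp hv) ?_
    have := hq.sub h0
    rw [sub_zero] at this
    refine this.congr fun n => ?_
    simp

theorem convex_factorM_image (hf₁ : ProperClosedConvex f₁) (hf₂ : ProperClosedConvex f₂) :
    Convex ℝ (factorM B₁ T₁ T₂ σ '' {p | IsKKT f₁ f₂ B₁ B₂ c p}) := by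
  rintro _ ⟨p, hp, rfl⟩ _ ⟨p', hp', rfl⟩ s t hs ht hst
  exact ⟨s • p + t • p', convex_setOf_isKKT hf₁ hf₂ hp hp' hs ht hst,
    by rw [map_add, map_smul, map_smul]⟩

theorem isClosed_factorM_image (hf₁ : ProperClosedConvex f₁) (hf₂ : ProperClosedConvex f₂)
    (hT₁ : T₁.IsPositive) (hT₂ : T₂.IsPositive) (hS₁ : IsConvexityOperator f₁ S₁)
    (hS₂ : IsConvexityOperator f₂ S₂) (hpd₁ : IsPosDef (S₁ + adjoint B₁ ∘ₗ B₁ + T₁))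
    (hpd₂ : IsPosDef (S₂ + adjoint B₂ ∘ₗ B₂ + T₂)) (hσ : 0 < σ) :
    IsClosed (factorM B₁ T₁ T₂ σ '' {p | IsKKT f₁ f₂ B₁ B₂ c p}) := by
  refine IsSeqClosed.isClosed fun qs q hqs hq => ?_
  choose ps hps hps' using hqs
  obtain ⟨v, hv, hvq, -⟩ := exists_tendsto_isKKT hf₁ hf₂ hT₁ hT₂ hS₁ hS₂ hpd₁ hpd₂ hσ
    (ws := ps) (vs := ps) (fun n => isProximalStep_self_iff.2 (hps n))
    (by simpa only [hps'] using hq) (by simp)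
  exact ⟨v, hv, hvq⟩

/-! ### Residual and objective gap after one step -/

namespace IsProximalStep

/-- The relaxed fixed-point residual `ρ (w - v)` is `1/2`-cocoercive in the seminorm `‖·‖_M`; this is
where `ρ ≤ 2` enters. -/
theorem cocoercive (hf₁ : ProperClosedConvex f₁) (hf₂ : ProperClosedConvex f₂)
    (hT₁ : T₁.IsPositive) (hT₂ : T₂.IsPositive) (hσ : 0 < σ) {ρ : ℝ} (hρ : 0 < ρ) (hρ2 : ρ ≤ 2)
    {w v w' v' : Y × Z × X} (h : IsProximalStep f₁ f₂ B₁ B₂ c T₁ T₂ σ w v)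
    (h' : IsProximalStep f₁ f₂ B₁ B₂ c T₁ T₂ σ w' v') :
    1 / 2 * ‖ρ • factorM B₁ T₁ T₂ σ (w - v - (w' - v'))‖ ^ 2 ≤
      inner ℝ (ρ • factorM B₁ T₁ T₂ σ (w - v - (w' - v'))) (factorM B₁ T₁ T₂ σ (w - w')) := by
  have hm := h.inner_sub_nonneg hf₁ hf₂ hT₁ hT₂ hσ h'
  rw [show v - v' = (w - w') - (w - v - (w' - v')) by abel, map_sub _ (w - w'),
    inner_sub_right, real_inner_self_eq_norm_sq] at hm
  rw [norm_smul, Real.norm_of_nonneg hρ.le, mul_pow, inner_smul_left, RCLike.conj_to_real]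
  calc 1 / 2 * (ρ ^ 2 * ‖factorM B₁ T₁ T₂ σ (w - v - (w' - v'))‖ ^ 2)
      = ρ * (ρ / 2 * ‖factorM B₁ T₁ T₂ σ (w - v - (w' - v'))‖ ^ 2) := by ring
    _ ≤ ρ * (1 * ‖factorM B₁ T₁ T₂ σ (w - v - (w' - v'))‖ ^ 2) := by gcongr; linarith
    _ ≤ _ := by gcongr; linarith

theorem prodNorm_kktResidual_le (hf₁ : ProperClosedConvex f₁) (hf₂ : ProperClosedConvex f₂)
    (hT₁ : T₁.IsPositive) (hT₂ : T₂.IsPositive) (hσ : 0 < σ) {w v : Y × Z × X}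
    (h : IsProximalStep f₁ f₂ B₁ B₂ c T₁ T₂ σ w v) :
    prodNorm (kktResidual f₁ f₂ B₁ B₂ c v) ≤
      resConst B₁ T₁ T₂ σ * ‖factorM B₁ T₁ T₂ σ (w - v)‖ := by
  have r1 := hf₁.norm_sub_prox_le h.fst_mem
  have r2 := hf₂.norm_sub_prox_le h.snd_mem
  have hs := norm_constraint_le (B₁ := B₁) hT₁ hT₂ hσ (w - v)
  have hty := (norm_apply_le_sqrtOp hT₁ (w - v).1).trans
    (mul_le_mul_of_nonneg_left (norm_sqrtOp_fst_le (B₁ := B₁) hT₁ hT₂ hσ (w - v))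
      (opNorm_nonneg _))
  have htz := (norm_apply_le_sqrtOp hT₂ (w - v).2.1).trans
    (mul_le_mul_of_nonneg_left (norm_sqrtOp_snd_le (B₁ := B₁) hT₁ hT₂ hσ (w - v))
      (opNorm_nonneg _))
  have hb := opNorm_nonneg (adjoint B₁)
  have hN := norm_nonneg (factorM B₁ T₁ T₂ σ (w - v))
  have ha : ‖σ • adjoint B₁ (B₁ (w - v).1 + σ⁻¹ • (w - v).2.2) + T₁ (w - v).1‖ ≤
      σ * (opNorm (adjoint B₁) * ‖B₁ (w - v).1 + σ⁻¹ • (w - v).2.2‖) + ‖T₁ (w - v).1‖ := by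
    refine (norm_add_le _ _).trans ?_
    rw [norm_smul, Real.norm_of_nonneg hσ.le]
    gcongr
    exact norm_apply_le_opNorm _ _
  have r1' := r1.trans ha
  have r3 : ‖c - B₁ v.1 - B₂ v.2.1‖ = ‖B₁ (w - v).1 + σ⁻¹ • (w - v).2.2‖ := by
    rw [← h.constraint]; rfl
  generalize ‖factorM B₁ T₁ T₂ σ (w - v)‖ = N at *
  have hs0 := norm_nonneg (B₁ (w - v).1 + σ⁻¹ • (w - v).2.2)
  generalize ‖B₁ (w - v).1 + σ⁻¹ • (w - v).2.2‖ = s at *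
  have hsum : prodNorm (kktResidual f₁ f₂ B₁ B₂ c v) ≤
      ‖v.1 - prox f₁ (v.1 - adjoint B₁ v.2.2)‖ + ‖v.2.1 - prox f₂ (v.2.1 - adjoint B₂ v.2.2)‖
        + ‖c - B₁ v.1 - B₂ v.2.1‖ := by
    rw [prodNorm, prodInner, kktResidual, real_inner_self_eq_norm_sq, real_inner_self_eq_norm_sq,
      real_inner_self_eq_norm_sq]
    refine Real.sqrt_le_iff.2 ⟨by positivity, ?_⟩
    have n1 := norm_nonneg (v.1 - prox f₁ (v.1 - adjoint B₁ v.2.2))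
    have n2 := norm_nonneg (v.2.1 - prox f₂ (v.2.1 - adjoint B₂ v.2.2))
    have n3 := norm_nonneg (c - B₁ v.1 - B₂ v.2.1)
    nlinarith [mul_nonneg n1 n2, mul_nonneg n1 n3, mul_nonneg n2 n3]
  have hsb : σ * (opNorm (adjoint B₁) * s) + s ≤ (σ * opNorm (adjoint B₁) + 1) / √σ * N := by
    calc σ * (opNorm (adjoint B₁) * s) + s = (σ * opNorm (adjoint B₁) + 1) * s := by ring
      _ ≤ (σ * opNorm (adjoint B₁) + 1) * (1 / √σ * N) := by gcongr
      _ = _ := by ring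
  rw [resConst, add_mul, add_mul]
  have r2' : ‖v.2.1 - prox f₂ (v.2.1 - adjoint B₂ v.2.2)‖ ≤ ‖T₂ (w - v).2.1‖ := r2
  linarith

/-- Lower bound for the objective gap, from the subgradients at the KKT point `p`. -/
theorem le_objGap (hf₁ : ProperClosedConvex f₁) (hf₂ : ProperClosedConvex f₂)
    (hT₁ : T₁.IsPositive) (hT₂ : T₂.IsPositive) (hσ : 0 < σ) {w v p : Y × Z × X}
    (h : IsProximalStep f₁ f₂ B₁ B₂ c T₁ T₂ σ w v) (hp : IsKKT f₁ f₂ B₁ B₂ c p) :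
    (-1 / √σ * ‖p.2.2‖) * ‖factorM B₁ T₁ T₂ σ (w - v)‖ ≤ objGap f₁ f₂ v.1 v.2.1 p.1 p.2.1 := by
  have i1 := (hf₁.mem_subdiff_iff.1 hp.1).2 _ (hf₁.mem_subdiff_iff.1 h.fst_mem).1
  have i2 := (hf₂.mem_subdiff_iff.1 hp.2.1).2 _ (hf₂.mem_subdiff_iff.1 h.snd_mem).1
  rw [inner_neg_left, LinearMap.adjoint_inner_left] at i1 i2
  have hs := norm_constraint_le (B₁ := B₁) hT₁ hT₂ hσ (w - v)
  have e : inner ℝ p.2.2 (B₁ (v.1 - p.1)) + inner ℝ p.2.2 (B₂ (v.2.1 - p.2.1)) =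
      -inner ℝ p.2.2 (B₁ (w - v).1 + σ⁻¹ • (w - v).2.2) := by
    rw [Prod.fst_sub, Prod.snd_sub, Prod.snd_sub, h.constraint, ← inner_neg_right,
      ← inner_add_right, map_sub, map_sub, ← sub_eq_zero, ← inner_sub_right,
      show B₁ v.1 - B₁ p.1 + (B₂ v.2.1 - B₂ p.2.1) - -(c - B₁ v.1 - B₂ v.2.1) =
        -(B₁ p.1 + B₂ p.2.1 - c) by abel, hp.2.2, neg_zero, inner_zero_right]
  have hin := (abs_le.1 (abs_real_inner_le_norm p.2.2 (B₁ (w - v).1 + σ⁻¹ • (w - v).2.2))).1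
  have hm := mul_le_mul_of_nonneg_left hs (norm_nonneg p.2.2)
  rw [objGap]
  have : (-1 / √σ * ‖p.2.2‖) * ‖factorM B₁ T₁ T₂ σ (w - v)‖ =
    -(‖p.2.2‖ * (1 / √σ * ‖factorM B₁ T₁ T₂ σ (w - v)‖)) := by ring
  linarith

/-- Upper bound for the objective gap, from the subgradients at the new point `v`. -/
theorem objGap_le (hf₁ : ProperClosedConvex f₁) (hf₂ : ProperClosedConvex f₂)
    (hT₁ : T₁.IsPositive) (hT₂ : T₂.IsPositive) (hσ : 0 < σ) {w v p : Y × Z × X}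
    (h : IsProximalStep f₁ f₂ B₁ B₂ c T₁ T₂ σ w v) (hp : IsKKT f₁ f₂ B₁ B₂ c p) :
    objGap f₁ f₂ v.1 v.2.1 p.1 p.2.1 ≤
      (‖factorM B₁ T₁ T₂ σ (w - p)‖ + 1 / √σ * ‖p.2.2‖) * ‖factorM B₁ T₁ T₂ σ (w - v)‖ := by
  have i1 := (hf₁.mem_subdiff_iff.1 h.fst_mem).2 _ (hf₁.mem_subdiff_iff.1 hp.1).1
  have i2 := (hf₂.mem_subdiff_iff.1 h.snd_mem).2 _ (hf₂.mem_subdiff_iff.1 hp.2.1).1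
  have hs := norm_constraint_le (B₁ := B₁) hT₁ hT₂ hσ (w - v)
  have hin := (abs_le.1 (abs_real_inner_le_norm p.2.2 (B₁ (w - v).1 + σ⁻¹ • (w - v).2.2))).2
  have hm := mul_le_mul_of_nonneg_left hs (norm_nonneg p.2.2)
  have hvp := h.norm_sub_le hf₁ hf₂ hT₁ hT₂ hσ (isProximalStep_self_iff.2 hp)
  have hLi := real_inner_le_norm (factorM B₁ T₁ T₂ σ (w - v)) (factorM B₁ T₁ T₂ σ (v - p))
  have hm2 := mul_le_mul_of_nonneg_left hvp (norm_nonneg (factorM B₁ T₁ T₂ σ (w - v)))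
  -- the gap is at most `⟨M (w - v), v - p⟩ + ⟨p_x, c - B₁ v_y - B₂ v_z⟩`
  have key : objGap f₁ f₂ v.1 v.2.1 p.1 p.2.1 ≤
      inner ℝ (factorM B₁ T₁ T₂ σ (w - v)) (factorM B₁ T₁ T₂ σ (v - p))
        + inner ℝ p.2.2 (B₁ (w - v).1 + σ⁻¹ • (w - v).2.2) := by
    have hc : B₁ (w - v).1 + σ⁻¹ • (w - v).2.2 = -(B₁ (v.1 - p.1) + B₂ (v.2.1 - p.2.1)) := by
      rw [Prod.fst_sub, Prod.snd_sub, Prod.snd_sub, h.constraint, map_sub, map_sub,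
        ← sub_eq_zero, show c - B₁ v.1 - B₂ v.2.1 - -(B₁ v.1 - B₁ p.1 + (B₂ v.2.1 - B₂ p.2.1)) =
        -(B₁ p.1 + B₂ p.2.1 - c) by abel, hp.2.2, neg_zero]
    have hce := congrArg (fun q => inner ℝ q (v.2.2 - p.2.2)) hc
    rw [inner_factorM hT₁ hT₂ hσ, objGap]
    rw [← neg_sub v.1 p.1, inner_neg_right] at i1
    rw [← neg_sub v.2.1 p.2.1, inner_neg_right] at i2
    simp only [Prod.fst_sub, Prod.snd_sub] at hce ⊢
    rw [real_inner_comm _ p.2.2]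
    generalize B₁ (w.1 - v.1) + σ⁻¹ • (w.2.2 - v.2.2) = s at *
    generalize v.1 - p.1 = dy at *
    generalize v.2.1 - p.2.1 = dz at *
    have h1 : inner ℝ (T₁ (w.1 - v.1)) dy = inner ℝ (w.1 - v.1) (T₁ dy) := hT₁.1 _ _
    have h2 : inner ℝ (T₂ (w.2.1 - v.2.1)) dz = inner ℝ (w.2.1 - v.2.1) (T₂ dz) := hT₂.1 _ _
    simp only [inner_sub_left, inner_add_left, inner_smul_left, LinearMap.adjoint_inner_left,
      RCLike.conj_to_real] at i1 i2
    rw [inner_add_right, inner_smul_right, mul_add, ← mul_assoc, mul_inv_cancel₀ hσ.ne', one_mul,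
      inner_sub_right]
    simp only [inner_neg_left, inner_add_left, inner_sub_right] at hce
    rw [real_inner_comm v.2.2 (B₁ dy), real_inner_comm v.2.2 (B₂ dz),
      real_inner_comm p.2.2 (B₁ dy), real_inner_comm p.2.2 (B₂ dz)] at hce
    have hcp := congrArg (fun q => inner ℝ q p.2.2) hc
    simp only [inner_neg_left, inner_add_left] at hcp
    rw [real_inner_comm p.2.2 (B₁ dy), real_inner_comm p.2.2 (B₂ dz)] at hcp
    linarith
  linarith

end IsProximalStep

end KKT

/-! ### The accelerated pADMM as an accelerated fixed-point sequence -/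

namespace IsGenerated

variable {Y Z X : Type*}
  [NormedAddCommGroup Y] [InnerProductSpace ℝ Y] [FiniteDimensional ℝ Y]
  [NormedAddCommGroup Z] [InnerProductSpace ℝ Z] [FiniteDimensional ℝ Z]
  [NormedAddCommGroup X] [InnerProductSpace ℝ X] [FiniteDimensional ℝ X]
  {f₁ : Y → EReal} {f₂ : Z → EReal} {B₁ : Y →ₗ[ℝ] X} {B₂ : Z →ₗ[ℝ] X} {c : X}
  {T₁ : Y →ₗ[ℝ] Y} {T₂ : Z →ₗ[ℝ] Z} {S₁ : Y →ₗ[ℝ] Y} {S₂ : Z →ₗ[ℝ] Z} {σ α ρ : ℝ}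
  {w wbar what : ℕ → Y × Z × X}

open LinearMap (adjoint)

/-- In the factor space the method is an accelerated fixed-point iteration with residual
`ρ L (w k - w̄ k)` and momentum `k L (w k - ŵ k)`. -/
theorem isAccelerated (hf₁ : ProperClosedConvex f₁) (hf₂ : ProperClosedConvex f₂)
    (hT₁ : T₁.IsPositive) (hT₂ : T₂.IsPositive) (hσ : 0 < σ) (hα : 0 < α) (hρ : 0 < ρ)
    (hρ2 : ρ ≤ 2) (h : IsGenerated f₁ f₂ B₁ B₂ c T₁ T₂ σ α ρ w wbar what) :
    IsAccelerated (α / 2 - 1) (fun k => factorM B₁ T₁ T₂ σ (w k))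
      (fun k => ρ • factorM B₁ T₁ T₂ σ (w k - wbar k))
      (fun k => (k : ℝ) • factorM B₁ T₁ T₂ σ (w k - what k)) where
  momentum_zero := by simp
  step k := by
    have hk : (k : ℝ) + α ≠ 0 := by positivity
    have e : ((k : ℝ) + α) • (w (k + 1) - w k) = (α / 2) • (what (k + 1) - w k)
        + (k : ℝ) • (what (k + 1) - what k) := by
      rw [h.step5 k, add_assoc, add_sub_cancel_left, smul_add, smul_smul, smul_smul]
      congr 2 <;> field_simp
    rw [show (k : ℝ) + 2 * (α / 2 - 1) + 2 = k + α by ring, ← map_sub, ← map_smul, ← map_smul,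
      ← map_smul, ← map_smul, ← map_sub, e, h.step4 k]
    congr 1
    module
  momentum_succ k := by
    rw [← map_sub, ← map_smul, ← map_smul, ← map_add, ← map_smul, h.step4 k]
    push_cast
    congr 1
    module
  cocoercive k := by
    have hm := (h.isProximalStep hf₁ hf₂ hT₁ hT₂ hσ (k + 1)).cocoercive hf₁ hf₂ hT₁ hT₂ hσ hρ hρ2
      (h.isProximalStep hf₁ hf₂ hT₁ hT₂ hσ k)
    rwa [← smul_sub, ← map_sub, ← map_sub]

theorem half_norm_sq_le_inner (hf₁ : ProperClosedConvex f₁) (hf₂ : ProperClosedConvex f₂)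
    (hT₁ : T₁.IsPositive) (hT₂ : T₂.IsPositive) (hσ : 0 < σ) (hρ : 0 < ρ) (hρ2 : ρ ≤ 2)
    (h : IsGenerated f₁ f₂ B₁ B₂ c T₁ T₂ σ α ρ w wbar what) {p : Y × Z × X}
    (hp : IsKKT f₁ f₂ B₁ B₂ c p) (k : ℕ) :
    1 / 2 * ‖ρ • factorM B₁ T₁ T₂ σ (w k - wbar k)‖ ^ 2 ≤
      inner ℝ (ρ • factorM B₁ T₁ T₂ σ (w k - wbar k))
        (factorM B₁ T₁ T₂ σ (w k) - factorM B₁ T₁ T₂ σ p) := by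
  have hm := (h.isProximalStep hf₁ hf₂ hT₁ hT₂ hσ k).cocoercive hf₁ hf₂ hT₁ hT₂ hσ hρ hρ2
    (isProximalStep_self_iff.2 hp)
  rwa [sub_self, sub_zero, map_sub _ (w k) p] at hm

/-- The sequence `L w` converges to the image of a KKT point, so the proximal points converge in norm
to a KKT point. -/
theorem exists_tendsto (hf₁ : ProperClosedConvex f₁) (hf₂ : ProperClosedConvex f₂)
    (hT₁ : T₁.IsPositive) (hT₂ : T₂.IsPositive) (hS₁ : IsConvexityOperator f₁ S₁)
    (hS₂ : IsConvexityOperator f₂ S₂) (hpd₁ : IsPosDef (S₁ + adjoint B₁ ∘ₗ B₁ + T₁))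
    (hpd₂ : IsPosDef (S₂ + adjoint B₂ ∘ₗ B₂ + T₂)) (hσ : 0 < σ) (hα : 2 ≤ α) (hρ : 0 < ρ)
    (hρ2 : ρ ≤ 2) (hKKT : ∃ p, IsKKT f₁ f₂ B₁ B₂ c p)
    (h : IsGenerated f₁ f₂ B₁ B₂ c T₁ T₂ σ α ρ w wbar what) :
    ∃ p, IsKKT f₁ f₂ B₁ B₂ c p ∧ Tendsto wbar atTop (𝓝 p) := by
  have hacc := h.isAccelerated hf₁ hf₂ hT₁ hT₂ hσ (by linarith) hρ hρ2
  have hstep := h.isProximalStep hf₁ hf₂ hT₁ hT₂ hσ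
  set P : Set (FactorSpace Y Z X) :=
    factorM B₁ T₁ T₂ σ '' {p | IsKKT f₁ f₂ B₁ B₂ c p}
  have hne : P.Nonempty := by
    obtain ⟨p, hp⟩ := hKKT
    exact ⟨_, Set.mem_image_of_mem _ hp⟩
  have hconv : Convex ℝ P := convex_factorM_image hf₁ hf₂
  have hclosed : IsClosed P := isClosed_factorM_image hf₁ hf₂ hT₁ hT₂ hS₁ hS₂ hpd₁ hpd₂ hσ
  have hp : ∀ q ∈ P, ∀ k, 1 / 2 * ‖ρ • factorM B₁ T₁ T₂ σ (w k - wbar k)‖ ^ 2 ≤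
      inner ℝ (ρ • factorM B₁ T₁ T₂ σ (w k - wbar k)) (factorM B₁ T₁ T₂ σ (w k) - q) := by
    rintro _ ⟨p, hpk, rfl⟩ k
    exact h.half_norm_sq_le_inner hf₁ hf₂ hT₁ hT₂ hσ hρ hρ2 hpk k
  have hdiv : ∀ φ : ℕ → ℕ, Tendsto (fun k => ρ • factorM B₁ T₁ T₂ σ (w (φ k) - wbar (φ k)))
      atTop (𝓝 0) → Tendsto (fun k => factorM B₁ T₁ T₂ σ (w (φ k) - wbar (φ k))) atTop (𝓝 0) := by
    intro φ hφ
    have := hφ.const_smul ρ⁻¹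
    simpa only [smul_smul, inv_mul_cancel₀ hρ.ne', one_smul, smul_zero] using this
  have hcl : ∀ φ : ℕ → ℕ, StrictMono φ → ∀ q,
      Tendsto ((fun k => factorM B₁ T₁ T₂ σ (w k)) ∘ φ) atTop (𝓝 q) →
      Tendsto ((fun k => ρ • factorM B₁ T₁ T₂ σ (w k - wbar k)) ∘ φ) atTop (𝓝 0) → q ∈ P := by
    intro φ _ q hq h0
    obtain ⟨v, hv, hvq, -⟩ := exists_tendsto_isKKT hf₁ hf₂ hT₁ hT₂ hS₁ hS₂ hpd₁ hpd₂ hσ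
      (ws := w ∘ φ) (vs := wbar ∘ φ) (fun n => hstep (φ n)) hq (hdiv φ h0)
    exact ⟨v, hv, hvq⟩
  have ha : 0 ≤ α / 2 - 1 := by linarith
  obtain ⟨q, hqP, hq⟩ := hacc.exists_tendsto ha hne hclosed hconv hp hcl
  have hr := hacc.tendsto_residual ha (hp q hqP)
  obtain ⟨v, hv, -, hlim⟩ := exists_tendsto_isKKT hf₁ hf₂ hT₁ hT₂ hS₁ hS₂ hpd₁ hpd₂ hσ
    hstep hq (hdiv id hr)
  exact ⟨v, hv, hlim⟩

/-- For `α = 2` the step length is `O(1 / k)` with the constant of the Halpern iteration. -/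
theorem norm_factorM_sub_le (hf₁ : ProperClosedConvex f₁) (hf₂ : ProperClosedConvex f₂)
    (hT₁ : T₁.IsPositive) (hT₂ : T₂.IsPositive) (hσ : 0 < σ) (hρ : 0 < ρ) (hρ2 : ρ ≤ 2)
    (h : IsGenerated f₁ f₂ B₁ B₂ c T₁ T₂ σ 2 ρ w wbar what) {p : Y × Z × X}
    (hp : IsKKT f₁ f₂ B₁ B₂ c p) (k : ℕ) :
    ‖factorM B₁ T₁ T₂ σ (w k - wbar k)‖ ≤
        2 * seminormM B₁ T₁ T₂ σ (w 0 - p) / (ρ * ((k : ℝ) + 1)) ∧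
      ‖factorM B₁ T₁ T₂ σ (w k - p)‖ ≤ seminormM B₁ T₁ T₂ σ (w 0 - p) := by
  have hacc := h.isAccelerated hf₁ hf₂ hT₁ hT₂ hσ zero_lt_two hρ hρ2
  rw [show (2 : ℝ) / 2 - 1 = 0 by norm_num] at hacc
  have hip := h.half_norm_sq_le_inner hf₁ hf₂ hT₁ hT₂ hσ hρ hρ2 hp
  have h1 := hacc.norm_residual_le hip k
  have h2 := hacc.norm_sub_le_norm_zero_sub hip k
  rw [← map_sub, ← map_sub] at h2
  rw [← map_sub, norm_smul, Real.norm_of_nonneg hρ.le, le_div_iff₀ (by positivity)] at h1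
  rw [seminormM_eq_norm_factorM hT₁ hT₂ hσ, le_div_iff₀ (by positivity)]
  exact ⟨by linarith, h2⟩

/-- For `α > 2` the step length is `o(1 / k)`. -/
theorem norm_factorM_sub_isLittleO (hf₁ : ProperClosedConvex f₁) (hf₂ : ProperClosedConvex f₂)
    (hT₁ : T₁.IsPositive) (hT₂ : T₂.IsPositive) (hσ : 0 < σ) (hα : 2 < α) (hρ : 0 < ρ)
    (hρ2 : ρ ≤ 2) (h : IsGenerated f₁ f₂ B₁ B₂ c T₁ T₂ σ α ρ w wbar what) {p : Y × Z × X}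
    (hp : IsKKT f₁ f₂ B₁ B₂ c p) :
    (fun k => ‖factorM B₁ T₁ T₂ σ (w k - wbar k)‖) =o[atTop] (fun k : ℕ => 1 / ((k : ℝ) + 1)) ∧
      ∃ R, ∀ k, ‖factorM B₁ T₁ T₂ σ (w k - p)‖ ≤ R := by
  have hacc := h.isAccelerated hf₁ hf₂ hT₁ hT₂ hσ (by linarith) hρ hρ2
  have hip := h.half_norm_sq_le_inner hf₁ hf₂ hT₁ hT₂ hσ hρ hρ2 hp
  have ha : 0 < α / 2 - 1 := by linarith
  constructor
  · have h1 := (hacc.tendsto_momentum_and_residual ha hip).2.norm.const_mul ρ⁻¹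
    rw [norm_zero, mul_zero] at h1
    refine (Asymptotics.isLittleO_iff_tendsto' ?_).2 (h1.congr fun k => ?_)
    · refine Eventually.of_forall fun k hk => ?_
      exact absurd hk (by positivity)
    · rw [norm_smul, norm_smul, Real.norm_of_nonneg hρ.le, Real.norm_of_nonneg (by positivity)]
      field_simp
  · obtain ⟨R, hR⟩ := hacc.exists_norm_sub_le ha hip
    exact ⟨R, fun k => by rw [map_sub]; exact hR k⟩

end IsGenerated

end AccPADMM

end

theorem mainTheorem1 {Y Z X : Type*}
    [NormedAddCommGroup Y] [InnerProductSpace ℝ Y] [FiniteDimensional ℝ Y]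
    [NormedAddCommGroup Z] [InnerProductSpace ℝ Z] [FiniteDimensional ℝ Z]
    [NormedAddCommGroup X] [InnerProductSpace ℝ X] [FiniteDimensional ℝ X]
    (f₁ : Y → EReal) (f₂ : Z → EReal)
    (hf₁ : AccPADMM.ProperClosedConvex f₁) (hf₂ : AccPADMM.ProperClosedConvex f₂)
    (B₁ : Y →ₗ[ℝ] X) (B₂ : Z →ₗ[ℝ] X) (c : X)
    (T₁ : Y →ₗ[ℝ] Y) (T₂ : Z →ₗ[ℝ] Z) (hT₁ : T₁.IsPositive) (hT₂ : T₂.IsPositive)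
    (S₁ : Y →ₗ[ℝ] Y) (S₂ : Z →ₗ[ℝ] Z)
    (hS₁ : AccPADMM.IsConvexityOperator f₁ S₁) (hS₂ : AccPADMM.IsConvexityOperator f₂ S₂)
    -- Solvability of the KKT system
    (hKKT : ∃ w, AccPADMM.IsKKT f₁ f₂ B₁ B₂ c w)
    -- Positive definiteness
    (hpd₁ : AccPADMM.IsPosDef (S₁ + LinearMap.adjoint B₁ ∘ₗ B₁ + T₁))
    (hpd₂ : AccPADMM.IsPosDef (S₂ + LinearMap.adjoint B₂ ∘ₗ B₂ + T₂))
    (σ α ρ : ℝ) (hσ : 0 < σ) (hα : 2 ≤ α) (hρ : 0 < ρ) (hρ2 : ρ ≤ 2)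
    (w wbar what : ℕ → Y × Z × X)
    (hgen : AccPADMM.IsGenerated f₁ f₂ B₁ B₂ c T₁ T₂ σ α ρ w wbar what) :
    ∃ wstar : Y × Z × X,
      Filter.Tendsto wbar Filter.atTop (nhds wstar) ∧
      AccPADMM.IsKKT f₁ f₂ B₁ B₂ c wstar ∧
      -- All objective values in the gap `h` are finite
      (wstar.1 ∈ AccPADMM.effDom f₁ ∧ wstar.2.1 ∈ AccPADMM.effDom f₂ ∧
        ∀ k, (wbar k).1 ∈ AccPADMM.effDom f₁ ∧ (wbar k).2.1 ∈ AccPADMM.effDom f₂) ∧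
      -- The case `α = 2`
      (α = 2 → ∀ k : ℕ,
        AccPADMM.prodNorm (AccPADMM.kktResidual f₁ f₂ B₁ B₂ c (wbar k)) ≤
          AccPADMM.resConst B₁ T₁ T₂ σ *
            (2 * AccPADMM.seminormM B₁ T₁ T₂ σ (w 0 - wstar) / (ρ * ((k : ℝ) + 1))) ∧
        (-1 / √σ * ‖wstar.2.2‖) *
            (2 * AccPADMM.seminormM B₁ T₁ T₂ σ (w 0 - wstar) / (ρ * ((k : ℝ) + 1))) ≤
          AccPADMM.objGap f₁ f₂ (wbar k).1 (wbar k).2.1 wstar.1 wstar.2.1 ∧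
        AccPADMM.objGap f₁ f₂ (wbar k).1 (wbar k).2.1 wstar.1 wstar.2.1 ≤
          (3 * AccPADMM.seminormM B₁ T₁ T₂ σ (w 0 - wstar) + 1 / √σ * ‖wstar.2.2‖) *
            (2 * AccPADMM.seminormM B₁ T₁ T₂ σ (w 0 - wstar) / (ρ * ((k : ℝ) + 1)))) ∧
      -- The case `α > 2`
      (2 < α →
        (∃ ε : ℕ → ℝ, ε =o[Filter.atTop] (fun k : ℕ => 1 / ((k : ℝ) + 1)) ∧
          ∀ k, AccPADMM.prodNorm (AccPADMM.kktResidual f₁ f₂ B₁ B₂ c (wbar k)) =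
            AccPADMM.resConst B₁ T₁ T₂ σ * ε k) ∧
        (fun k => |AccPADMM.objGap f₁ f₂ (wbar k).1 (wbar k).2.1 wstar.1 wstar.2.1|)
          =o[Filter.atTop] (fun k : ℕ => 1 / ((k : ℝ) + 1))) := by
  have hstep := hgen.isProximalStep hf₁ hf₂ hT₁ hT₂ hσ
  obtain ⟨p, hp, hlim⟩ := hgen.exists_tendsto hf₁ hf₂ hT₁ hT₂ hS₁ hS₂ hpd₁ hpd₂ hσ hα hρ hρ2 hKKT
  obtain ⟨hp1, hp2⟩ := hp.mem_effDom hf₁ hf₂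
  have hC : 0 < AccPADMM.resConst B₁ T₁ T₂ σ := by
    have h1 := AccPADMM.opNorm_nonneg (LinearMap.adjoint B₁)
    have h2 := AccPADMM.opNorm_nonneg (AccPADMM.sqrtOp T₁)
    have h3 := AccPADMM.opNorm_nonneg (AccPADMM.sqrtOp T₂)
    have h4 := Real.sqrt_pos.2 hσ
    unfold AccPADMM.resConst
    positivity
  have hres := fun k => (hstep k).prodNorm_kktResidual_le hf₁ hf₂ hT₁ hT₂ hσ
  have hlow := fun k => (hstep k).le_objGap hf₁ hf₂ hT₁ hT₂ hσ hp
  have hupp := fun k => (hstep k).objGap_le hf₁ hf₂ hT₁ hT₂ hσ hp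
  have hx : 0 ≤ 1 / √σ * ‖p.2.2‖ := by positivity
  refine ⟨p, hlim, hp, ⟨hp1, hp2, fun k => ⟨(hf₁.mem_subdiff_iff.1 (hstep k).fst_mem).1,
    (hf₂.mem_subdiff_iff.1 (hstep k).snd_mem).1⟩⟩, ?_, fun hα' => ?_⟩
  · rintro rfl k
    obtain ⟨h1, h2⟩ := hgen.norm_factorM_sub_le hf₁ hf₂ hT₁ hT₂ hσ hρ hρ2 hp k
    have hR : 0 ≤ AccPADMM.seminormM B₁ T₁ T₂ σ (w 0 - p) := Real.sqrt_nonneg _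
    refine ⟨(hres k).trans (mul_le_mul_of_nonneg_left h1 hC.le), le_trans ?_ (hlow k),
      (hupp k).trans ?_⟩
    · refine mul_le_mul_of_nonpos_left h1 ?_
      rw [neg_div, neg_mul]
      linarith
    · gcongr
      linarith
  · obtain ⟨ho, R, hR⟩ := hgen.norm_factorM_sub_isLittleO hf₁ hf₂ hT₁ hT₂ hσ hα' hρ hρ2 hp
    refine ⟨⟨fun k => AccPADMM.prodNorm (AccPADMM.kktResidual f₁ f₂ B₁ B₂ c (wbar k)) /
      AccPADMM.resConst B₁ T₁ T₂ σ, ?_, fun k => by field_simp⟩, ?_⟩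
    · refine Asymptotics.IsBigO.trans_isLittleO (Asymptotics.IsBigO.of_bound 1 ?_) ho
      refine Filter.Eventually.of_forall fun k => ?_
      have hnn : 0 ≤ AccPADMM.prodNorm (AccPADMM.kktResidual f₁ f₂ B₁ B₂ c (wbar k)) :=
        Real.sqrt_nonneg _
      rw [Real.norm_of_nonneg (div_nonneg hnn hC.le), norm_norm, one_mul,
        div_le_iff₀ hC, mul_comm]
      exact hres k
    · refine Asymptotics.IsBigO.trans_isLittleO
        (Asymptotics.IsBigO.of_bound (R + 1 / √σ * ‖p.2.2‖) ?_) ho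
      refine Filter.Eventually.of_forall fun k => ?_
      have hN := norm_nonneg (AccPADMM.factorM B₁ T₁ T₂ σ (w k - wbar k))
      have hR0 : 0 ≤ R := (norm_nonneg _).trans (hR k)
      rw [Real.norm_of_nonneg (abs_nonneg _), norm_norm, abs_le]
      constructor
      · refine le_trans ?_ (hlow k)
        rw [neg_div, neg_mul, ← neg_mul]
        gcongr
        linarith
      · refine (hupp k).trans ?_
        gcongr
        exact hR k
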